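/- For $N\ge 1$ let $W_{\ge}^N=\{x\in\mathbb{R}^N : 0\le x_1\le\cdots\le x_N\}$, let $\mathring W_{\ge}^N=\{0<x_1<\cdots<x_N\}$, let $\Delta_N(x)=\prod_{1\le i<j\le N}(x_j-x_i)$, and write $(a)_n=a(a+1)\cdots(a+n-1)$. For $\mathfrak{s}>-1$ and $\alpha>-1$ the Pickrell ensemble is the probability measure on $W_{\ge}^N$ $$m^N_{\mathfrak{s},\alpha}(dx)=\frac1{Z^N_{\mathfrak{s},\alpha}}\,\Delta_N(x)^2\prod_{k=1}^N x_k^{\alpha}(1+x_k)^{-2N-\alpha-\mathfrak{s}}\,dx ,$$ where $Z^N_{\mathfrak{s},\alpha}$ is the normalising constant. Consider the following Markov kernels. * $L^{N+1}_N$ from $W_{\ge}^{N+1}$ to $W_{\ge}^N$: for $x$ with $x_1<\cdots<x_{N+1}$, $$L^{N+1}_N(x,dy)=N!\,\frac{\Delta_N(y)}{\Delta_{N+1}(x)}\,\mathbf 1\{x_1\le y_1\le x_2\le\cdots\le y_N\le x_{N+1}\}\,dy .$$ * $\Lambda^N_{\alpha,N}$ from $W_{\ge}^N$ to $W_{\ge}^N$: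 for $x\in\mathring W_{\ge}^N$, $$\Lambda^N_{\alpha,N}(x,dy)=(\alpha+1)_N\Big(\prod_{k=1}^N\frac{y_k^{\alpha}}{x_k^{\alpha+1}}\Big)\frac{\Delta_N(y)}{\Delta_N(x)}\,\mathbf 1\{0\le y_1\le x_1\le y_2\le\cdots\le y_N\le x_N\}\,dy .$$ * $\Lambda^{N+1}_{\alpha,N}$ from $W_{\ge}^{N+1}$ to $W_{\ge}^N$: for $x\in\mathring W_{\ge}^{N+1}$, with $x_0=0$ and $y_{N+1}=\infty$, $$\Lambda^{N+1}_{\alpha,N}(x,dy)=N!\,(\alpha+1)_N\,\frac{\Delta_N(y)}{\Delta_{N+1}(x)}\prod_{k=1}^N\bigg(\mathbf 1_{[x_{k-1},x_{k+1}]}(y_k)\int_{x_k\vee y_k}^{x_{k+1}\wedge y_{k+1}}\frac{y_k^{\alpha}}{z^{\alpha+1}}\,dz\bigg)dy .$$ At the remaining points $x$ each kernel is defined by continuous extension: its value is the probability measure whose integrals against continuous functions vanishing at infinity are the limits of those at the points above. For a measure $m$ and a kernel $K$ write $mK(A)=\int K(x,A)\,m(dx)$. Then for all $\mathfrak{s}>-1$,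 $\alpha>-1$ and $N\ge1$, $$m^{N+1}_{\mathfrak{s},\alpha}L^{N+1}_N=m^N_{\mathfrak{s},\alpha+1},\qquad m^N_{\mathfrak{s},\alpha+1}\Lambda^N_{\alpha,N}=m^N_{\mathfrak{s},\alpha},\qquad m^{N+1}_{\mathfrak{s},\alpha}\Lambda^{N+1}_{\alpha,N}=m^N_{\mathfrak{s},\alpha}.$$ In particular, $\{m^N_{\mathfrak{s},\alpha}\}_{N\ge1}$ is a coherent family of probability measures with respect to the kernels $\{\Lambda^{N+1}_{\alpha,N}\}_{N\ge1}$. -/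

import Mathlib

open MeasureTheory Filter Topology
open scoped Nat

noncomputable section

namespace Pickrell

/-- The closed nonnegative Weyl chamber `{0 ≤ x₁ ≤ ⋯ ≤ x_N}`. As a type it carries the subspace
topology and the Borel σ-algebra. -/
def chamber (N : ℕ) : Set (Fin N → ℝ) := {x | Monotone x ∧ ∀ i, 0 ≤ x i}

/-- Lebesgue measure on the chamber. -/
def lebesgue (N : ℕ) : Measure (chamber N) := (volume : Measure (Fin N → ℝ)).comap Subtype.val

/-- The Vandermonde determinant `Δ_N(x) = ∏_{i<j} (x_j - x_i)`. -/
def vandermonde {N : ℕ} (x : Fin N → ℝ) : ℝ := ∏ i, ∏ j ∈ Finset.Ioi i, (x j - x i)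

/-- The shifted factorial `(a)_n = a (a+1) ⋯ (a+n-1)`. -/
def shiftedFactorial (a : ℝ) (n : ℕ) : ℝ := (ascPochhammer ℝ n).eval a

/-! ### The Pickrell ensembles -/

/-- `Δ_N(x)² ∏ x_k^α (1+x_k)^{-2N-α-s}`. -/
def ensembleWeight (s α : ℝ) {N : ℕ} (x : Fin N → ℝ) : ℝ :=
  vandermonde x ^ 2 * ∏ k, (x k ^ α * (1 + x k) ^ (-2 * (N : ℝ) - α - s))

/-- The measure on the chamber with density `ensembleWeight`, before normalisation. -/
def unnormalizedEnsemble (s α : ℝ) (N : ℕ) : Measure (chamber N) :=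
  (lebesgue N).withDensity fun x => ENNReal.ofReal (ensembleWeight s α x.1)

/-- The Pickrell ensemble `m^N_{s,α}`. -/
def ensemble (s α : ℝ) (N : ℕ) : Measure (chamber N) :=
  (unnormalizedEnsemble s α N Set.univ)⁻¹ • unnormalizedEnsemble s α N

/-! ### Extending a family of measures to a Feller kernel -/

open Classical in
/-- The continuous extension to all of `X` of a family `k` of measures given by a formula at the
points of a dense set `S`: at `x ∉ S` it is the probability measure `μ` with
`∫ f dμ = lim_{x' → x, x' ∈ S} ∫ f dk(x')` for all `f` in `C_∞(Y)`. Hence, if a Markov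
kernel `X ⇢ Y` that maps `C_∞(Y)` into `C_∞(X)` agrees with `k` on `S`, it is this extension.
(If no such `μ` exists the value is the zero measure.) -/
def fellerExtension {X Y : Type*} [TopologicalSpace X] [TopologicalSpace Y] [MeasurableSpace Y]
    (S : Set X) (k : X → Measure Y) (x : X) : Measure Y :=
  if x ∈ S then k x
  else if h : ∃ μ : Measure Y, IsProbabilityMeasure μ ∧
      ∀ f : ZeroAtInftyContinuousMap Y ℝ,
        Tendsto (fun x' => ∫ y, f y ∂(k x')) (𝓝[S] x) (𝓝 (∫ y, f y ∂μ))
    then h.choose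
  else 0

/-! ### The kernel `L^{N+1}_N` -/

/-- Points of the chamber with pairwise distinct coordinates. -/
def distinctPoints (N : ℕ) : Set (chamber N) := {x | StrictMono x.1}

/-- The `y` with `x₁ ≤ y₁ ≤ x₂ ≤ ⋯ ≤ y_N ≤ x_{N+1}`. -/
def interlacing {N : ℕ} (x : Fin (N + 1) → ℝ) : Set (Fin N → ℝ) :=
  {y | ∀ k : Fin N, x k.castSucc ≤ y k ∧ y k ≤ x k.succ}

/-- `N! (Δ_N(y) / Δ_{N+1}(x)) 1(y interlaces with x)`. -/
def cornerDensity {N : ℕ} (x : Fin (N + 1) → ℝ) : (Fin N → ℝ) → ℝ :=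
  (interlacing x).indicator fun y => (N ! : ℝ) * (vandermonde y / vandermonde x)

/-- The kernel `L^{N+1}_N` from the chamber of `ℝ^{N+1}` to that of `ℝ^N`. -/
def cornerKernel (N : ℕ) : chamber (N + 1) → Measure (chamber N) :=
  fellerExtension (distinctPoints (N + 1)) fun x =>
    (lebesgue N).withDensity fun y => ENNReal.ofReal (cornerDensity x.1 y.1)

/-! ### The kernel `Λ^N_{α,N}` -/

/-- The points of the chamber with `0 < x₁ < ⋯ < x_N`. -/
def interiorPoints (N : ℕ) : Set (chamber N) := {x | StrictMono x.1 ∧ ∀ i, 0 < x.1 i}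

/-- The `y` with `0 ≤ y₁ ≤ x₁ ≤ y₂ ≤ x₂ ≤ ⋯ ≤ y_N ≤ x_N`. -/
def sameSizeInterlacing {N : ℕ} (x : Fin N → ℝ) : Set (Fin N → ℝ) :=
  {y | (∀ k, 0 ≤ y k ∧ y k ≤ x k) ∧ ∀ i j : Fin N, (i : ℕ) + 1 = j → x i ≤ y j}

/-- `(α+1)_N (∏ y_k^α / x_k^{α+1}) (Δ_N(y) / Δ_N(x)) 1(y interlaces with x)`. -/
def sameSizeDensity (α : ℝ) {N : ℕ} (x : Fin N → ℝ) : (Fin N → ℝ) → ℝ :=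
  (sameSizeInterlacing x).indicator fun y =>
    shiftedFactorial (α + 1) N * (∏ k, y k ^ α / x k ^ (α + 1)) *
      (vandermonde y / vandermonde x)

/-- The kernel `Λ^N_{α,N}` from the chamber of `ℝ^N` to itself. -/
def sameSizeKernel (α : ℝ) (N : ℕ) : chamber N → Measure (chamber N) :=
  fellerExtension (interiorPoints N) fun x =>
    (lebesgue N).withDensity fun y => ENNReal.ofReal (sameSizeDensity α x.1 y.1)

/-! ### The kernel `Λ^{N+1}_{α,N}`

The coordinates `x_1, …, x_{N+1}` and `y_1, …, y_N` are indexed from `0` in Lean: for `k : Fin N`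
standing for the `(k+1)`-st index, `x_{k+1}` is `x k.castSucc` and `x_{k+2}` is `x k.succ`. -/

/-- The coordinate of `x` two places before `x k.succ`, which is `0` (the value `x_0`) if `k` is the
first index. -/
def prevCoord {N : ℕ} (x : Fin (N + 1) → ℝ) (k : Fin N) : ℝ :=
  if (k : ℕ) = 0 then 0 else x ⟨k - 1, by omega⟩

/-- The minimum of `x k.succ` and the coordinate of `y` after `y k`, the latter being `∞` (the value
`y_{N+1}`) if `k` is the last index. -/
def upperEnd {N : ℕ} (x : Fin (N + 1) → ℝ) (y : Fin N → ℝ) (k : Fin N) : ℝ :=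
  if h : (k : ℕ) + 1 < N then min (x k.succ) (y ⟨k + 1, h⟩) else x k.succ

/-- `N! (α+1)_N (Δ_N(y) / Δ_{N+1}(x)) ∏_{k=1}^N (1_{[x_{k-1}, x_{k+1}]}(y_k)
∫_{x_k ∨ y_k}^{x_{k+1} ∧ y_{k+1}} y_k^α / z^{α+1} dz)`, with `x_0 = 0` and `y_{N+1} = ∞`. -/
def linkDensity (α : ℝ) {N : ℕ} (x : Fin (N + 1) → ℝ) (y : Fin N → ℝ) : ℝ :=
  (N ! : ℝ) * shiftedFactorial (α + 1) N * (vandermonde y / vandermonde x) *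
    ∏ k : Fin N,
      (Set.Icc (prevCoord x k) (x k.succ)).indicator
        (fun yk => ∫ z in (max (x k.castSucc) yk)..(upperEnd x y k), yk ^ α / z ^ (α + 1)) (y k)

/-- The kernel `Λ^{N+1}_{α,N}` from the chamber of `ℝ^{N+1}` to that of `ℝ^N`. -/
def linkKernel (α : ℝ) (N : ℕ) : chamber (N + 1) → Measure (chamber N) :=
  fellerExtension (interiorPoints (N + 1)) fun x =>
    (lebesgue N).withDensity fun y => ENNReal.ofReal (linkDensity α x.1 y.1)

/-! ### Coherence -/

/-- A family `m N` (`N ≥ 1`) of measures is coherent for the kernels `K N` from `E (N+1)` to `E N`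
if every `m N` is a probability measure and `m (N+1) K N = m N`. Here `mK(A) = ∫ K(x, A) m(dx)`
is `Measure.bind m K`. -/
def IsCoherent {E : ℕ → Type*} [∀ N, MeasurableSpace (E N)]
    (K : ∀ N, E (N + 1) → Measure (E N)) (m : ∀ N, Measure (E N)) : Prop :=
  (∀ N, 1 ≤ N → IsProbabilityMeasure (m N)) ∧ ∀ N, 1 ≤ N → (m (N + 1)).bind (K N) = m N

end Pickrell

end

noncomputable section

namespace Pickrell

/-! ### Determinants -/

/-! Each kernel sends the weight of one ensemble to a constant multiple of the weight of another. As
the kernel is Markov, comparing total masses forces the constant, so no normalising constant has to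
be computed (`bind_normalized_withDensity`). What remains is to integrate weight times density over
`x` for fixed `y`.

For `L` and `Λ^N` the factor `Δ(x)` in the denominator of the density cancels one of the two in the
weight. This leaves `Δ(x) ∏ w(x_k)` on a product of intervals, because interlacing with a fixed `y`
constrains each coordinate of `x` separately. It is a determinant whose row `i` depends on `x_i`
alone, so it integrates to a determinant of one-variable integrals, which un-telescopes into a
determinant of primitives at the end points (`lintegral_pi_det`). Column operations replace
`t^{j+1}` by `t^{j+1} + c_j t^j`, with `c_j` chosen to make the product with `w` proportional to the
derivative of some `t^a (1+t)^{-b}`. These primitives vanish at infinity and, for `L`, at `0`; the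
boundary rows collapse and the Vandermonde determinant of `y` is left (`lintegral_corner_box`,
`lintegral_sameSize_box`). The same method with `x` fixed and pure powers as integrands gives the
kernels mass one.

The third kernel is `L` followed by `Λ^N`: once the intermediate point `z` is integrated, `Δ(z)`
cancels and the integral factors over coordinates (`ofReal_linkDensity`). The third identity then
follows from the first two by Tonelli. Almost every point is interior, so the continuous extensions
never enter. -/

theorem vandermonde_eq_det {n : ℕ} (x : Fin n → ℝ) :
    vandermonde x = (Matrix.of fun i j : Fin n => x i ^ (j : ℕ)).det :=
  (Matrix.det_vandermonde x).symm

/-- A two-term triangular change of basis does not change the Vandermonde determinant. -/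
theorem vandermonde_eq_det_add_pred {n : ℕ} (c : Fin n → ℝ) (x : Fin (n + 1) → ℝ) :
    vandermonde x = (Matrix.of fun i : Fin (n + 1) =>
      (Fin.cons 1 (fun j : Fin n => x i ^ (j + 1 : ℕ) + c j * x i ^ (j : ℕ)) :
        Fin (n + 1) → ℝ)).det := by
  rw [vandermonde_eq_det]
  refine Matrix.det_eq_of_forall_col_eq_smul_add_pred (fun j => -c j) (fun i => by simp) ?_
  intro i j
  simp

/-- The determinant of consecutive row differences. -/
theorem det_row_sub {n : ℕ} (g : Fin (n + 1) → Fin n → ℝ) :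
    (Matrix.of fun i j : Fin n => g i.succ j - g i.castSucc j).det =
      (Matrix.of fun i : Fin (n + 1) => (Fin.cons 1 (g i) : Fin (n + 1) → ℝ)).det := by
  -- Subtracting from each row the one above turns the column of ones into `(1, 0, …, 0)`; expanding
  -- along it leaves the matrix of differences.
  let B : Matrix (Fin (n + 1)) (Fin (n + 1)) ℝ := Matrix.of
    (Fin.cons (Fin.cons 1 (g 0)) fun i : Fin n => Fin.cons 0 fun j => g i.succ j - g i.castSucc j)
  have hB : (Matrix.of fun i : Fin (n + 1) => (Fin.cons 1 (g i) : Fin (n + 1) → ℝ)).det = B.det := by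
    refine Matrix.det_eq_of_forall_row_eq_smul_add_pred (fun _ => 1) (fun j => by simp [B]) ?_
    intro i j
    refine Fin.cases ?_ (fun j => ?_) j <;> simp [B]
  rw [hB, Matrix.det_succ_column_zero, Fin.sum_univ_succ]
  simp only [B, Matrix.of_apply, Fin.cons_zero, Fin.cons_succ]
  simp
  rfl

/-- Expansion along a first row of the form `(a, 0, …, 0)`. -/
theorem det_first_row {n : ℕ} (A : Matrix (Fin (n + 1)) (Fin (n + 1)) ℝ)
    (h : ∀ j : Fin n, A 0 j.succ = 0) :
    A.det = A 0 0 * (Matrix.of fun i j : Fin n => A i.succ j.succ).det := by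
  rw [Matrix.det_succ_row_zero, Fin.sum_univ_succ]
  simp [h]
  left
  rfl

/-- Expansion along a last row of the form `(a, 0, …, 0)`. -/
theorem det_last_row {n : ℕ} (A : Matrix (Fin (n + 1)) (Fin (n + 1)) ℝ)
    (h : ∀ j : Fin n, A (Fin.last n) j.succ = 0) :
    A.det = (-1) ^ n * A (Fin.last n) 0 * (Matrix.of fun i j : Fin n => A i.castSucc j.succ).det := by
  rw [Matrix.det_succ_row A (Fin.last n), Fin.sum_univ_succ]
  simp [h]
  left
  rfl

/-! ### Integrals of determinants over products -/

theorem integrable_det_pi {n : ℕ} (μ : Fin n → Measure ℝ) [∀ i, SigmaFinite (μ i)]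
    (f : Fin n → ℝ → ℝ) (hf : ∀ i j, Integrable (f j) (μ i)) :
    Integrable (fun x : Fin n → ℝ => (Matrix.of fun i j => f j (x i)).det) (Measure.pi μ) := by
  simp_rw [← Matrix.det_transpose (Matrix.of _), Matrix.det_apply', Matrix.transpose_apply,
    Matrix.of_apply]
  refine integrable_finsetSum _ fun σ _ => Integrable.const_mul ?_ _
  exact Integrable.fintype_prod (f := fun i => f (σ i)) fun i => hf i (σ i)

/-- Each term of the Leibniz expansion takes one factor from each row, hence one function of each
variable, and Fubini applies term by term. -/
theorem integral_det_pi {n : ℕ} (μ : Fin n → Measure ℝ) [∀ i, SigmaFinite (μ i)]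
    (f : Fin n → ℝ → ℝ) (hf : ∀ i j, Integrable (f j) (μ i)) :
    ∫ x : Fin n → ℝ, (Matrix.of fun i j => f j (x i)).det ∂(Measure.pi μ) =
      (Matrix.of fun i j => ∫ t, f j t ∂(μ i)).det := by
  simp_rw [← Matrix.det_transpose (Matrix.of _), Matrix.det_apply', Matrix.transpose_apply,
    Matrix.of_apply]
  rw [integral_finsetSum]
  · refine Finset.sum_congr rfl fun σ _ => ?_
    rw [integral_const_mul, integral_fintype_prod_eq_prod (fun i => f (σ i))]
  · refine fun σ _ => Integrable.const_mul ?_ _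
    exact Integrable.fintype_prod (f := fun i => f (σ i)) fun i => hf i (σ i)

/-- The integral of `det (f_j(x_i))` over a product of sets, expressed through primitives `g` of
the `f_j` at the end points. -/
theorem lintegral_pi_det {n : ℕ} (I : Fin n → Set ℝ) (hI : ∀ i, MeasurableSet (I i))
    (f : Fin n → ℝ → ℝ) (g : Fin (n + 1) → Fin n → ℝ)
    (hf : ∀ i j, IntegrableOn (f j) (I i))
    (hg : ∀ i j, ∫ t in I i, f j t = g i.succ j - g i.castSucc j)
    (h : (Fin n → ℝ) → ℝ) (hh : ∀ x ∈ Set.univ.pi I, h x = (Matrix.of fun i j => f j (x i)).det)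
    (h0 : ∀ x ∈ Set.univ.pi I, 0 ≤ h x) :
    ∫⁻ x in Set.univ.pi I, ENNReal.ofReal (h x) = ENNReal.ofReal
      (Matrix.of fun i : Fin (n + 1) => (Fin.cons 1 (g i) : Fin (n + 1) → ℝ)).det := by
  have hm : MeasurableSet (Set.univ.pi I) := MeasurableSet.univ_pi hI
  rw [setLIntegral_congr_fun hm
    (g := fun x => ENNReal.ofReal (Matrix.of fun i j => f j (x i)).det)
    fun x hx => by simp only [hh x hx], ← det_row_sub]
  simp_rw [← hg]
  rw [← integral_det_pi (fun i => volume.restrict (I i)) f hf,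
    ofReal_integral_eq_lintegral_ofReal (integrable_det_pi _ f hf), volume_pi,
    Measure.restrict_pi_pi]
  rw [← Measure.restrict_pi_pi]
  refine (ae_restrict_iff' hm).2 (ae_of_all _ fun x hx => ?_)
  simpa only [Pi.zero_apply, hh x hx] using h0 x hx

/-! ### Primitives on intervals of the half-line -/

/-- `{t | a ≤ t ≤ b}` for `b` possibly infinite. -/
def closedInterval (a : ℝ) (b : WithTop ℝ) : Set ℝ := {t | a ≤ t ∧ (t : WithTop ℝ) ≤ b}

@[simp] theorem closedInterval_coe (a b : ℝ) : closedInterval a b = Set.Icc a b := by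
  ext t; simp [closedInterval]

@[simp] theorem closedInterval_top (a : ℝ) : closedInterval a ⊤ = Set.Ici a := by
  ext t; simp [closedInterval]

theorem measurableSet_closedInterval (a : ℝ) (b : WithTop ℝ) :
    MeasurableSet (closedInterval a b) := by
  induction b with
  | top => simp
  | coe b => simp

/-- The extension of a function on the line by zero at infinity. -/
def zeroAtTop (F : ℝ → ℝ) : WithTop ℝ → ℝ := WithTop.recTopCoe 0 F

@[simp] theorem zeroAtTop_top (F : ℝ → ℝ) : zeroAtTop F ⊤ = 0 := rfl
@[simp] theorem zeroAtTop_coe (F : ℝ → ℝ) (a : ℝ) : zeroAtTop F a = F a := rfl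

/-- Differentiability is asked only on the open half-line, since the derivatives used below may be
singular at `0`. Decay at infinity makes `zeroAtTop F` the right boundary value for both kinds of
interval. -/
theorem setIntegral_closedInterval {F f : ℝ → ℝ} (hF : ContinuousOn F (Set.Ici 0))
    (hd : ∀ x, 0 < x → HasDerivAt F (f x) x) (hf : IntegrableOn f (Set.Ioi 0))
    (h0 : Tendsto F atTop (𝓝 0)) {a : ℝ} (ha : 0 ≤ a) {b : WithTop ℝ} (hab : a ≤ b) :
    ∫ t in closedInterval a b, f t = zeroAtTop F b - F a := by
  induction b with
  | top =>
    rw [closedInterval_top, integral_Ici_eq_integral_Ioi]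
    exact integral_Ioi_of_hasDerivAt_of_tendsto ((hF a ha).mono (Set.Ici_subset_Ici.2 ha))
      (fun x hx => hd x (ha.trans_lt hx)) (hf.mono_set (Set.Ioi_subset_Ioi ha)) h0
  | coe b =>
    have hab : a ≤ b := by simpa using hab
    rw [closedInterval_coe, integral_Icc_eq_integral_Ioc, ← intervalIntegral.integral_of_le hab]
    exact intervalIntegral.integral_eq_sub_of_hasDerivAt_of_le hab
      (hF.mono fun x hx => ha.trans hx.1) (fun x hx => hd x (ha.trans_lt hx.1))
      ((intervalIntegrable_iff_integrableOn_Ioc_of_le hab).2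
        (hf.mono_set fun x hx => ha.trans_lt hx.1))

theorem integrableOn_closedInterval {f : ℝ → ℝ} (hf : IntegrableOn f (Set.Ioi 0)) {a : ℝ}
    (ha : 0 ≤ a) (b : WithTop ℝ) : IntegrableOn f (closedInterval a b) :=
  ((integrableOn_Ici_iff_integrableOn_Ioi).2 hf).mono_set fun _ ht => ha.trans ht.1

/-- `x^a (1+x)^{-b}` is integrable on the half-line if `a > -1` and `b > a + 1`. -/
theorem integrableOn_rpow_mul_one_add_rpow {a b : ℝ} (ha : -1 < a) (hab : a + 1 < b) :
    IntegrableOn (fun x : ℝ => x ^ a * (1 + x) ^ (-b)) (Set.Ioi 0) := by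
  have hmeas : Measurable fun x : ℝ => x ^ a * (1 + x) ^ (-b) := by fun_prop
  rw [← Set.Ioc_union_Ioi_eq_Ioi (zero_le_one' ℝ)]
  refine IntegrableOn.union ?_ ?_
  · have h1 : IntegrableOn (fun x : ℝ => x ^ a) (Set.Ioc 0 1) :=
      (intervalIntegrable_iff_integrableOn_Ioc_of_le zero_le_one).1
        (intervalIntegral.intervalIntegrable_rpow' ha)
    refine Integrable.mono' h1 hmeas.aestronglyMeasurable
      ((ae_restrict_iff' measurableSet_Ioc).2 (ae_of_all _ fun x hx => ?_))
    have hx0 : 0 < x := hx.1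
    rw [Real.norm_of_nonneg (by positivity)]
    exact mul_le_of_le_one_right (by positivity)
      (Real.rpow_le_one_of_one_le_of_nonpos (by linarith) (by linarith))
  · have h1 : IntegrableOn (fun x : ℝ => x ^ (a - b)) (Set.Ioi 1) :=
      integrableOn_Ioi_rpow_of_lt (by linarith) one_pos
    refine Integrable.mono' h1 hmeas.aestronglyMeasurable
      ((ae_restrict_iff' measurableSet_Ioi).2 (ae_of_all _ fun x hx => ?_))
    have hx0 : 0 < x := one_pos.trans hx
    rw [Real.norm_of_nonneg (by positivity), sub_eq_add_neg, Real.rpow_add hx0]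
    refine mul_le_mul_of_nonneg_left ?_ (by positivity)
    exact Real.rpow_le_rpow_of_nonpos hx0 (by linarith) (by linarith)

/-- The derivative of `x^a (1+x)^{-b}`. -/
def betaDeriv (a b x : ℝ) : ℝ :=
  a * (x ^ (a - 1) * (1 + x) ^ (-(b + 1))) + (a - b) * (x ^ a * (1 + x) ^ (-(b + 1)))

/-- Both terms are brought to the common factor `(1+x)^{-(b+1)}`, so that the derivative is a weight
times a two-term combination of consecutive powers. -/
theorem hasDerivAt_beta (a b : ℝ) {x : ℝ} (hx : 0 < x) :
    HasDerivAt (fun x : ℝ => x ^ a * (1 + x) ^ (-b)) (betaDeriv a b x) x := by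
  have h1 := Real.hasDerivAt_rpow_const (x := x) (p := a) (Or.inl hx.ne')
  have h2 : HasDerivAt (fun x : ℝ => (1 + x) ^ (-b)) (-b * (1 + x) ^ (-b - 1)) x := by
    have := ((hasDerivAt_id x).const_add 1).rpow_const (p := -b) (Or.inl (by simp; positivity))
    simpa using this
  refine (h1.mul h2).congr_deriv ?_
  have e1 : (1 + x) ^ (-b) = (1 + x) * (1 + x) ^ (-(b + 1)) := by
    rw [mul_comm, ← Real.rpow_add_one (by positivity)]; congr 1; ring
  have e2 : x ^ a = x * x ^ (a - 1) := by
    rw [mul_comm, ← Real.rpow_add_one hx.ne']; congr 1; ring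
  rw [betaDeriv, e1, e2, show -b - 1 = -(b + 1) by ring]
  ring

theorem integrableOn_betaDeriv {a b : ℝ} (ha : 0 ≤ a) (hab : a < b) :
    IntegrableOn (betaDeriv a b) (Set.Ioi 0) := by
  refine Integrable.add ?_ ?_
  -- For `a = 0` the power `x^{-1}` is not integrable at `0`, but its coefficient `a` vanishes.
  · rcases ha.eq_or_lt with rfl | ha
    · simp
    · exact (integrableOn_rpow_mul_one_add_rpow (by linarith) (by linarith)).const_mul _
  · exact (integrableOn_rpow_mul_one_add_rpow (by linarith) (by linarith)).const_mul _

theorem continuousOn_beta {a : ℝ} (b : ℝ) (ha : 0 ≤ a) :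
    ContinuousOn (fun x : ℝ => x ^ a * (1 + x) ^ (-b)) (Set.Ici 0) := by
  refine (Real.continuous_rpow_const ha).continuousOn.mul ?_
  refine ContinuousOn.rpow_const (by fun_prop) fun x hx => Or.inl ?_
  have : (0 : ℝ) ≤ x := hx
  positivity

theorem tendsto_beta {a b : ℝ} (ha : 0 ≤ a) (hab : a < b) :
    Tendsto (fun x : ℝ => x ^ a * (1 + x) ^ (-b)) atTop (𝓝 0) := by
  have h1 : Tendsto (fun x : ℝ => x ^ (-(b - a))) atTop (𝓝 0) :=
    tendsto_rpow_neg_atTop (by linarith)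
  refine squeeze_zero' ?_ ?_ h1
  · filter_upwards [eventually_gt_atTop 0] with x hx
    positivity
  · filter_upwards [eventually_gt_atTop 0] with x hx
    rw [show -(b - a) = a + -b by ring, Real.rpow_add hx]
    refine mul_le_mul_of_nonneg_left ?_ (by positivity)
    exact Real.rpow_le_rpow_of_nonpos hx (by linarith) (by linarith)

theorem setIntegral_betaDeriv {a b : ℝ} (ha : 0 ≤ a) (hab : a < b) {p : ℝ} (hp : 0 ≤ p)
    {q : WithTop ℝ} (hpq : p ≤ q) :
    ∫ t in closedInterval p q, betaDeriv a b t =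
      zeroAtTop (fun x => x ^ a * (1 + x) ^ (-b)) q - p ^ a * (1 + p) ^ (-b) :=
  setIntegral_closedInterval (continuousOn_beta b ha) (fun _ => hasDerivAt_beta a b)
    (integrableOn_betaDeriv ha hab) (tendsto_beta ha hab) hp hpq

theorem setIntegral_Icc_rpow {r p q : ℝ} (hr : -1 < r) (hpq : p ≤ q) :
    ∫ t in Set.Icc p q, t ^ r = q ^ (r + 1) / (r + 1) - p ^ (r + 1) / (r + 1) := by
  rw [integral_Icc_eq_integral_Ioc, ← intervalIntegral.integral_of_le hpq,
    integral_rpow (Or.inl hr), sub_div]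

theorem integrableOn_Icc_rpow {r p q : ℝ} (hr : -1 < r) (hpq : p ≤ q) :
    IntegrableOn (fun t : ℝ => t ^ r) (Set.Icc p q) :=
  (intervalIntegrable_iff_integrableOn_Icc_of_le hpq).1
    (intervalIntegral.intervalIntegrable_rpow' hr)

/-! ### Markov kernels given by densities -/

theorem measurable_withDensity_kernel {X Y : Type*} [MeasurableSpace X] [MeasurableSpace Y]
    {ν : Measure Y} [SFinite ν] {k : X → Y → ENNReal} (hk : Measurable (Function.uncurry k)) :
    Measurable fun x => ν.withDensity (k x) := by
  refine Measure.measurable_of_measurable_coe _ fun A hA => ?_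
  simp_rw [withDensity_apply _ hA]
  exact Measurable.lintegral_prod_right' (ν := ν.restrict A) hk

/-- A Markov kernel with density `k` maps the normalisation of the density `u` to the normalisation
of the density `v`, provided that it maps `u` to a multiple of `v`. -/
theorem bind_normalized_withDensity {X Y : Type*} [MeasurableSpace X] [MeasurableSpace Y]
    {μ : Measure X} {ν : Measure Y} [SFinite μ] [SFinite ν] {u : X → ENNReal} {v : Y → ENNReal}
    (hu : Measurable u) (hv : Measurable v) {k : X → Y → ENNReal}
    (hk : Measurable (Function.uncurry k)) {K : X → Measure Y}
    (hK : ∀ᵐ x ∂μ, K x = ν.withDensity (k x)) (hk1 : ∀ᵐ x ∂μ, ∫⁻ y, k x y ∂ν = 1)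
    {c : ENNReal} (hc : ∀ᵐ y ∂ν, ∫⁻ x, u x * k x y ∂μ = c * v y)
    (h0 : μ.withDensity u Set.univ ≠ 0) (htop : μ.withDensity u Set.univ ≠ ⊤) :
    ((μ.withDensity u Set.univ)⁻¹ • μ.withDensity u).bind K =
      (ν.withDensity v Set.univ)⁻¹ • ν.withDensity v := by
  set Z := μ.withDensity u Set.univ with hZ
  have hac : Z⁻¹ • μ.withDensity u ≪ μ :=
    (Measure.smul_absolutelyContinuous).trans (withDensity_absolutelyContinuous μ u)
  -- `K` is controlled only almost everywhere; no measurability of the Feller extension off the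
  -- dense set is needed.
  have hKm : AEMeasurable K (Z⁻¹ • μ.withDensity u) :=
    ⟨_, measurable_withDensity_kernel (ν := ν) hk, hac.ae_le hK⟩
  have key : ∀ A, MeasurableSet A →
      (Z⁻¹ • μ.withDensity u).bind K A = Z⁻¹ * c * ν.withDensity v A := by
    intro A hA
    rw [Measure.bind_apply hA hKm, lintegral_smul_measure, smul_eq_mul, mul_assoc]
    congr 1
    have hm : Measurable fun x => ∫⁻ y in A, k x y ∂ν :=
      Measurable.lintegral_prod_right' (ν := ν.restrict A) hk
    calc ∫⁻ x, K x A ∂(μ.withDensity u)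
        = ∫⁻ x, ∫⁻ y in A, k x y ∂ν ∂(μ.withDensity u) := by
          refine lintegral_congr_ae ?_
          filter_upwards [(withDensity_absolutelyContinuous μ u).ae_le hK] with x hx
          rw [hx, withDensity_apply _ hA]
      _ = ∫⁻ x, ∫⁻ y in A, u x * k x y ∂ν ∂μ := by
          rw [lintegral_withDensity_eq_lintegral_mul _ hu hm]
          refine lintegral_congr fun x => ?_
          rw [Pi.mul_apply, lintegral_const_mul]
          exact hk.of_uncurry_left
      _ = ∫⁻ y in A, ∫⁻ x, u x * k x y ∂μ ∂ν := by
          rw [lintegral_lintegral_swap]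
          exact ((hu.comp measurable_fst).mul hk).aemeasurable
      _ = ∫⁻ y in A, c * v y ∂ν := lintegral_congr_ae (ae_restrict_of_ae hc)
      _ = c * ν.withDensity v A := by rw [lintegral_const_mul _ hv, withDensity_apply _ hA]
  have htot : (Z⁻¹ • μ.withDensity u).bind K Set.univ = 1 := by
    rw [Measure.bind_apply MeasurableSet.univ hKm]
    have : ∀ᵐ x ∂(Z⁻¹ • μ.withDensity u), K x Set.univ = 1 := by
      filter_upwards [hac.ae_le hK, hac.ae_le hk1] with x hx hx1
      rw [hx, withDensity_apply _ MeasurableSet.univ, setLIntegral_univ, hx1]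
    rw [lintegral_congr_ae this, lintegral_const, one_mul, Measure.smul_apply, smul_eq_mul, ← hZ,
      ENNReal.inv_mul_cancel h0 htop]
  -- The image has total mass one, and this identifies the constant.
  have hc' : Z⁻¹ * c = (ν.withDensity v Set.univ)⁻¹ :=
    ENNReal.eq_inv_of_mul_eq_one_left (by rw [← key _ MeasurableSet.univ, htot])
  ext A hA
  rw [key A hA, hc', Measure.smul_apply, smul_eq_mul]

/-! ### Lebesgue measure on the chamber -/

theorem isClosed_chamber (N : ℕ) : IsClosed (chamber N) := by
  simp only [chamber, Monotone, Set.ofPred_and, Set.ofPred_forall]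
  refine IsClosed.inter ?_ ?_
  · exact isClosed_iInter fun i => isClosed_iInter fun j => isClosed_iInter fun _ =>
      isClosed_le (continuous_apply i) (continuous_apply j)
  · exact isClosed_iInter fun i => isClosed_le continuous_const (continuous_apply i)

theorem measurableSet_chamber (N : ℕ) : MeasurableSet (chamber N) :=
  (isClosed_chamber N).measurableSet

theorem measurable_coord {A : Type*} [MeasurableSpace A] {N : ℕ} {f : A → chamber N}
    (hf : Measurable f) (i : Fin N) : Measurable fun a => (f a).1 i :=
  (measurable_pi_apply i).comp (measurable_subtype_coe.comp hf)

theorem map_lebesgue (N : ℕ) :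
    (lebesgue N).map Subtype.val = (volume : Measure (Fin N → ℝ)).restrict (chamber N) :=
  map_comap_subtype_coe (measurableSet_chamber N) _

instance sFinite_lebesgue (N : ℕ) : SFinite (lebesgue N) := by
  have : SigmaFinite ((lebesgue N).map Subtype.val) := by rw [map_lebesgue]; infer_instance
  have := SigmaFinite.of_map (lebesgue N) measurable_subtype_coe.aemeasurable this
  infer_instance

theorem ae_lebesgue {N : ℕ} {p : (Fin N → ℝ) → Prop} (h : ∀ᵐ x, p x) :
    ∀ᵐ x ∂lebesgue N, p x.1 := by
  refine ae_of_ae_map measurable_subtype_coe.aemeasurable ?_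
  rw [map_lebesgue]
  exact ae_restrict_of_ae h

theorem ae_injective (N : ℕ) : ∀ᵐ x : Fin N → ℝ, Function.Injective x := by
  have h : ∀ i j : Fin N, i ≠ j → ∀ᵐ x : Fin N → ℝ, x i ≠ x j := by
    intro i j hij
    let l : (Fin N → ℝ) →ₗ[ℝ] ℝ := 
      (LinearMap.proj i : (Fin N → ℝ) →ₗ[ℝ] ℝ) - LinearMap.proj j
    have hl : LinearMap.ker l ≠ ⊤ := by
      intro h
      have : Pi.single i (1 : ℝ) ∈ LinearMap.ker l := by rw [h]; trivial
      simp [l, hij] at this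
    have h0 := Measure.addHaar_submodule volume _ hl
    refine measure_mono_null (fun x hx => ?_) h0
    have : x i = x j := by simpa using hx
    simp [l, this]
  simp only [Function.Injective]
  refine ae_all_iff.2 fun i => ae_all_iff.2 fun j => ?_
  by_cases hij : i = j
  · simp [hij]
  · filter_upwards [h i j hij] with x hx h1
    exact absurd h1 hx

theorem ae_ne_zero (N : ℕ) : ∀ᵐ x : Fin N → ℝ, ∀ i, x i ≠ 0 := by
  refine ae_all_iff.2 fun i => ?_
  exact measure_mono_null (fun x hx => by simpa using hx)
    (Measure.pi_hyperplane (fun _ : Fin N => (volume : Measure ℝ)) i 0)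

/-- This is why the values of the kernels at boundary points are irrelevant: every identity is
checked on interior points only. -/
theorem ae_mem_interiorPoints (N : ℕ) : ∀ᵐ x ∂lebesgue N, x ∈ interiorPoints N := by
  filter_upwards [ae_lebesgue (ae_injective N), ae_lebesgue (ae_ne_zero N)] with x h1 h2
  exact ⟨x.2.1.strictMono_of_injective h1, fun i => lt_of_le_of_ne (x.2.2 i) (h2 i).symm⟩

/-- An integral over the chamber of a function supported by a set `B` contained in the chamber. -/
theorem lintegral_lebesgue_indicator {N : ℕ} {B : Set (Fin N → ℝ)} (hB : MeasurableSet B)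
    (hsub : B ⊆ chamber N) (f : (Fin N → ℝ) → ENNReal) {F : chamber N → ENNReal}
    (h : ∀ᵐ x ∂lebesgue N, F x = B.indicator f x.1) :
    ∫⁻ x, F x ∂lebesgue N = ∫⁻ x in B, f x := by
  rw [lintegral_congr_ae h, lebesgue, lintegral_subtype_comap (measurableSet_chamber N),
    setLIntegral_indicator hB, Set.inter_eq_left.2 hsub]

theorem vandermonde_nonneg {N : ℕ} {x : Fin N → ℝ} (hx : Monotone x) : 0 ≤ vandermonde x :=
  Finset.prod_nonneg fun _ _ => Finset.prod_nonneg fun _ hj =>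
    sub_nonneg.2 (hx (Finset.mem_Ioi.1 hj).le)

theorem vandermonde_pos {N : ℕ} {x : Fin N → ℝ} (hx : StrictMono x) : 0 < vandermonde x :=
  Finset.prod_pos fun _ _ => Finset.prod_pos fun _ hj =>
    sub_pos.2 (hx (Finset.mem_Ioi.1 hj))

@[fun_prop]
theorem continuous_vandermonde (N : ℕ) : Continuous (vandermonde : (Fin N → ℝ) → ℝ) := by
  unfold vandermonde
  fun_prop

@[fun_prop]
theorem measurable_vandermonde (N : ℕ) : Measurable (vandermonde : (Fin N → ℝ) → ℝ) :=
  (continuous_vandermonde N).measurable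

/-! ### The ensembles -/

theorem measurable_ensembleWeight (s α : ℝ) (N : ℕ) :
    Measurable (ensembleWeight s α : (Fin N → ℝ) → ℝ) := by
  unfold ensembleWeight
  fun_prop

theorem ensembleWeight_nonneg (s α : ℝ) {N : ℕ} (x : chamber N) : 0 ≤ ensembleWeight s α x.1 := by
  refine mul_nonneg (sq_nonneg _) (Finset.prod_nonneg fun i _ => ?_)
  have := x.2.2 i
  positivity

/-- The chamber contains a nonempty open set, the cone of strict inequalities. -/
theorem lebesgue_univ_ne_zero (N : ℕ) : lebesgue N Set.univ ≠ 0 := by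
  have h1 : lebesgue N Set.univ = volume (chamber N) := by
    rw [lebesgue, comap_subtype_coe_apply (measurableSet_chamber N)]; simp
  let U : Set (Fin N → ℝ) := {x | (∀ i j, i < j → x i < x j) ∧ ∀ i, 0 < x i}
  have hU : IsOpen U := by
    simp only [U, Set.ofPred_and, Set.ofPred_forall]
    refine IsOpen.inter ?_ ?_
    · exact isOpen_iInter_of_finite fun i => isOpen_iInter_of_finite fun j =>
        isOpen_iInter_of_finite fun _ => isOpen_lt (continuous_apply i) (continuous_apply j)
    · exact isOpen_iInter_of_finite fun i => isOpen_lt continuous_const (continuous_apply i)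
  have hne : U.Nonempty := ⟨fun i => (i : ℝ) + 1, fun i j h => by simpa using h, fun i => by
    positivity⟩
  have hsub : U ⊆ chamber N := fun x hx => ⟨StrictMono.monotone fun i j h => hx.1 i j h,
    fun i => (hx.2 i).le⟩
  rw [h1]
  exact ((hU.measure_pos volume hne).trans_le (measure_mono hsub)).ne'

theorem unnormalizedEnsemble_univ_ne_zero (s α : ℝ) (N : ℕ) :
    unnormalizedEnsemble s α N Set.univ ≠ 0 := by
  rw [unnormalizedEnsemble, withDensity_apply _ MeasurableSet.univ, setLIntegral_univ]
  intro h
  have hm : Measurable fun x : chamber N => ENNReal.ofReal (ensembleWeight s α x.1) :=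
    ((measurable_ensembleWeight s α N).comp measurable_subtype_coe).ennreal_ofReal
  rw [lintegral_eq_zero_iff hm] at h
  have hF : ∀ᵐ x ∂lebesgue N, False := by
    filter_upwards [h, ae_mem_interiorPoints N] with x hx hi
    have hpos : 0 < ensembleWeight s α x.1 := by
      refine mul_pos (pow_pos (vandermonde_pos hi.1) 2) (Finset.prod_pos fun i _ => ?_)
      have := hi.2 i
      positivity
    simp only [Pi.zero_apply, ENNReal.ofReal_eq_zero] at hx
    linarith
  rw [ae_iff] at hF
  exact lebesgue_univ_ne_zero N (by simpa using hF)

/-- Bound `x_j - x_i` by `1 + x_j`. With indices from `0`, the coordinate `j` is the larger one in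
exactly `j ≤ N - 1` factors. -/
theorem vandermonde_sq_le {N : ℕ} (x : chamber N) :
    vandermonde x.1 ^ 2 ≤ ∏ i, (1 + x.1 i) ^ (2 * ((N : ℝ) - 1)) := by
  have h1 : vandermonde x.1 ≤ ∏ j, (1 + x.1 j) ^ (j : ℕ) := by
    calc vandermonde x.1 ≤ ∏ i, ∏ j ∈ Finset.Ioi i, (1 + x.1 j) := by
          refine Finset.prod_le_prod (fun i _ => Finset.prod_nonneg fun j hj => ?_) fun i _ =>
            Finset.prod_le_prod (fun j hj => ?_) fun j _ => ?_
          · exact sub_nonneg.2 (x.2.1 (Finset.mem_Ioi.1 hj).le)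
          · exact sub_nonneg.2 (x.2.1 (Finset.mem_Ioi.1 hj).le)
          · linarith [x.2.2 i]
      _ = ∏ j, ∏ _i ∈ Finset.Iio j, (1 + x.1 j) :=
          Finset.prod_comm' (by simp)
      _ = _ := by simp
  calc vandermonde x.1 ^ 2 ≤ (∏ j, (1 + x.1 j) ^ (j : ℕ)) ^ 2 :=
        pow_le_pow_left₀ (vandermonde_nonneg x.2.1) h1 2
    _ ≤ _ := by
        rw [← Finset.prod_pow]
        refine Finset.prod_le_prod (fun i _ => sq_nonneg _) fun i _ => ?_
        have hi := x.2.2 i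
        have hN : (i : ℝ) + 1 ≤ N := by exact_mod_cast i.2
        rw [← pow_mul, ← Real.rpow_natCast]
        refine Real.rpow_le_rpow_of_exponent_le (by linarith) ?_
        push_cast
        linarith

theorem unnormalizedEnsemble_univ_ne_top {s α : ℝ} (hs : -1 < s) (hα : -1 < α) (N : ℕ) :
    unnormalizedEnsemble s α N Set.univ ≠ ⊤ := by
  rw [unnormalizedEnsemble, withDensity_apply _ MeasurableSet.univ, setLIntegral_univ]
  -- The exponent is `2(N-1) - 2N - α - s = -(α+s+2)`. Integrability at `0` uses `α > -1`, and at
  -- infinity `s > -1`.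
  have hint : Integrable (fun x : Fin N → ℝ => ∏ i, x i ^ α * (1 + x i) ^ (-(α + s + 2)))
      (Measure.pi fun _ => volume.restrict (Set.Ici 0)) := by
    refine Integrable.fintype_prod (f := fun _ t => t ^ α * (1 + t) ^ (-(α + s + 2))) fun _ => ?_
    exact (integrableOn_Ici_iff_integrableOn_Ioi).2
      (integrableOn_rpow_mul_one_add_rpow hα (by linarith))
  rw [← Measure.restrict_pi_pi, ← volume_pi] at hint
  have hle : ∀ x : chamber N, ENNReal.ofReal (ensembleWeight s α x.1) ≤
      ‖∏ i, x.1 i ^ α * (1 + x.1 i) ^ (-(α + s + 2))‖ₑ := by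
    intro x
    refine ENNReal.ofReal_le_of_le_toReal ?_
    rw [toReal_enorm, Real.norm_of_nonneg (Finset.prod_nonneg fun i _ => by
      have := x.2.2 i; positivity)]
    calc ensembleWeight s α x.1 ≤ (∏ i, (1 + x.1 i) ^ (2 * ((N : ℝ) - 1))) *
          ∏ k, (x.1 k ^ α * (1 + x.1 k) ^ (-2 * (N : ℝ) - α - s)) := by
          refine mul_le_mul_of_nonneg_right (vandermonde_sq_le x)
            (Finset.prod_nonneg fun i _ => ?_)
          have := x.2.2 i; positivity
      _ = _ := by
          rw [← Finset.prod_mul_distrib]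
          refine Finset.prod_congr rfl fun i _ => ?_
          have := x.2.2 i
          rw [mul_left_comm, ← Real.rpow_add (by positivity)]
          congr 2; ring
  refine ne_top_of_le_ne_top ?_ (lintegral_mono hle)
  rw [lebesgue, lintegral_subtype_comap (measurableSet_chamber N)
    (fun x => ‖∏ i, x i ^ α * (1 + x i) ^ (-(α + s + 2))‖ₑ)]
  refine ne_top_of_le_ne_top hint.2.ne (lintegral_mono_set fun x hx i _ => hx.2 i)

theorem isProbabilityMeasure_ensemble {s α : ℝ} (hs : -1 < s) (hα : -1 < α) (N : ℕ) :
    IsProbabilityMeasure (ensemble s α N) := by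
  refine ⟨?_⟩
  rw [ensemble, Measure.smul_apply, smul_eq_mul, ENNReal.inv_mul_cancel
    (unnormalizedEnsemble_univ_ne_zero s α N) (unnormalizedEnsemble_univ_ne_top hs hα N)]

/-! ### Shifted factorials and auxiliary integrals over half-line intervals. -/

theorem shiftedFactorial_eq_prod (a : ℝ) (n : ℕ) : shiftedFactorial a n = ∏ j : Fin n, (a + j) := by
  rw [Fin.prod_univ_eq_prod_range (fun j : ℕ => a + (j : ℝ))]
  unfold shiftedFactorial
  induction n with
  | zero => simp
  | succ n ih => rw [ascPochhammer_succ_eval, ih, Finset.prod_range_succ]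

/-- The rules for real powers are applied at positive arguments; the possible end point `0` is a
null set. -/
theorem ae_restrict_closedInterval_eq {f f' : ℝ → ℝ} (h : ∀ t, 0 < t → f t = f' t) {a : ℝ}
    (ha : 0 ≤ a) (b : WithTop ℝ) : f =ᵐ[volume.restrict (closedInterval a b)] f' := by
  refine (ae_restrict_iff' (measurableSet_closedInterval a b)).2 ?_
  filter_upwards [Measure.ae_ne volume (0 : ℝ)] with t ht hmem
  exact h t (lt_of_le_of_ne (ha.trans hmem.1) ht.symm)

/-- Serves the column formed by the bare weight, whose primitive is taken to be its own integral
from `0`. -/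
theorem setIntegral_closedInterval_eq_sub {f : ℝ → ℝ} (hf : IntegrableOn f (Set.Ioi 0)) {a : ℝ}
    (ha : 0 ≤ a) {b : WithTop ℝ} (hab : a ≤ b) :
    ∫ t in closedInterval a b, f t =
      (∫ t in closedInterval 0 b, f t) - ∫ t in closedInterval 0 a, f t := by
  have h : closedInterval 0 b = Set.Ico 0 a ∪ closedInterval a b := by
    ext t
    simp only [closedInterval, Set.mem_ofPred_eq, Set.mem_union, Set.mem_Ico]
    constructor
    · rintro ⟨h0, h1⟩
      rcases lt_or_ge t a with h | h
      · exact Or.inl ⟨h0, h⟩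
      · exact Or.inr ⟨h, h1⟩
    · rintro (⟨h0, h1⟩ | ⟨h0, h1⟩)
      · exact ⟨h0, le_trans (by exact_mod_cast h1.le) hab⟩
      · exact ⟨ha.trans h0, h1⟩
  have hi := integrableOn_closedInterval hf le_rfl (a : WithTop ℝ)
  rw [closedInterval_coe] at hi
  rw [h, setIntegral_union _ (measurableSet_closedInterval a b) (hi.mono_set Set.Ico_subset_Icc_self)
    (integrableOn_closedInterval hf ha b), closedInterval_coe, integral_Icc_eq_integral_Ico]
  · ring
  · exact Set.disjoint_left.2 fun t h1 h2 => absurd h1.2 (not_lt.2 h2.1)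

/-! ### The kernel `L^{N+1}_N` -/

theorem interlacing_eq_pi {N : ℕ} (x : Fin (N + 1) → ℝ) :
    interlacing x = Set.univ.pi fun k : Fin N => Set.Icc (x k.castSucc) (x k.succ) := by
  ext y; simp only [interlacing, Set.mem_univ_pi, Set.mem_Icc, Set.mem_ofPred_eq]

theorem interlacing_subset_chamber {N : ℕ} (x : chamber (N + 1)) :
    interlacing x.1 ⊆ chamber N := by
  intro y hy
  refine ⟨fun i j hij => ?_, fun i => (x.2.2 _).trans (hy i).1⟩
  rcases hij.eq_or_lt with rfl | hij
  · exact le_rfl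
  · exact ((hy i).2.trans (x.2.1 (Fin.succ_le_castSucc_iff.2 hij))).trans (hy j).1

theorem measurable_cornerDensity (N : ℕ) :
    Measurable (Function.uncurry fun (x : chamber (N + 1)) (y : chamber N) =>
      ENNReal.ofReal (cornerDensity x.1 y.1)) := by
  have hS : MeasurableSet {p : chamber (N + 1) × chamber N | p.2.1 ∈ interlacing p.1.1} := by
    simp only [interlacing, Set.mem_ofPred_eq]
    simp only [Set.ofPred_forall, Set.ofPred_and]
    exact MeasurableSet.iInter fun k =>
      (measurableSet_le (measurable_coord measurable_fst _) (measurable_coord measurable_snd _)).inter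
        (measurableSet_le (measurable_coord measurable_snd _) (measurable_coord measurable_fst _))
  have hm : Measurable fun p : chamber (N + 1) × chamber N =>
      (N ! : ℝ) * (vandermonde p.2.1 / vandermonde p.1.1) := by fun_prop
  exact (hm.indicator hS).ennreal_ofReal

/-- The primitives `t^{j+1}/(j+1)`, bordered by a column of ones, form the Vandermonde matrix of `x`
up to column factors whose product is `1/N!`. -/
theorem lintegral_cornerDensity {N : ℕ} {x : chamber (N + 1)} (hx : x ∈ distinctPoints (N + 1)) :
    ∫⁻ y : chamber N, ENNReal.ofReal (cornerDensity x.1 y.1) ∂lebesgue N = 1 := by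
  have hΔ := vandermonde_pos hx
  have hmono : ∀ i : Fin N, x.1 i.castSucc ≤ x.1 i.succ := fun i =>
    x.2.1 (Fin.castSucc_le_succ i)
  rw [lintegral_lebesgue_indicator (B := interlacing x.1)
    (f := fun y => ENNReal.ofReal (N ! / vandermonde x.1) * ENNReal.ofReal (vandermonde y))
    (by rw [interlacing_eq_pi]; exact MeasurableSet.univ_pi fun _ => measurableSet_Icc)
    (interlacing_subset_chamber x)]
  · rw [lintegral_const_mul _ (by fun_prop), interlacing_eq_pi, lintegral_pi_det _
      (fun _ => measurableSet_Icc) (fun j t => t ^ (j : ℝ))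
      (fun i j => x.1 i ^ ((j : ℝ) + 1) / ((j : ℝ) + 1))
      (fun i j => integrableOn_Icc_rpow (by linarith [(j : ℕ).cast_nonneg (α := ℝ)]) (hmono i))
      (fun i j => setIntegral_Icc_rpow (by linarith [(j : ℕ).cast_nonneg (α := ℝ)]) (hmono i))
      vandermonde (fun y _ => by simp [vandermonde_eq_det])
      (fun y hy => vandermonde_nonneg (interlacing_subset_chamber x
        (by rwa [interlacing_eq_pi])).1)]
    have hdet : (Matrix.of fun i : Fin (N + 1) => (Fin.cons 1
        (fun j : Fin N => x.1 i ^ ((j : ℝ) + 1) / ((j : ℝ) + 1)) : Fin (N + 1) → ℝ)).det =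
        vandermonde x.1 / N ! := by
      have hv : ∏ j : Fin (N + 1), (Fin.cons 1 (fun j : Fin N => ((j : ℝ) + 1)⁻¹) :
          Fin (N + 1) → ℝ) j = (N ! : ℝ)⁻¹ := by
        rw [Fin.prod_univ_succ]
        simp only [Fin.cons_zero, Fin.cons_succ, one_mul, Finset.prod_inv_distrib]
        rw [Fin.prod_univ_eq_prod_range (fun j : ℕ => (j : ℝ) + 1),
          ← Finset.prod_range_add_one_eq_factorial]
        push_cast; rfl
      rw [vandermonde_eq_det, div_eq_inv_mul, ← hv, ← Matrix.det_mul_row]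
      congr 1
      ext i j
      refine Fin.cases ?_ (fun j => ?_) j
      · simp
      · simp [div_eq_inv_mul, ← Real.rpow_natCast]
    rw [hdet, ← ENNReal.ofReal_mul (by positivity)]
    rw [show (N ! : ℝ) / vandermonde x.1 * (vandermonde x.1 / N !) = 1 by field_simp]
    simp
  · refine ae_of_all _ fun y => ?_
    by_cases hy : y.1 ∈ interlacing x.1
    · rw [cornerDensity, Set.indicator_of_mem hy, Set.indicator_of_mem hy,
        ← ENNReal.ofReal_mul (by positivity)]
      congr 1; ring
    · rw [cornerDensity, Set.indicator_of_notMem hy, Set.indicator_of_notMem hy]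
      simp

/-- The points of `[0, ∞]` formed by `0`, the coordinates of `y`, and `∞`. -/
def extendedPoints {N : ℕ} (y : Fin N → ℝ) : Fin (N + 2) → WithTop ℝ :=
  Fin.cons 0 (Fin.snoc (α := fun _ => WithTop ℝ) (fun i => (y i : WithTop ℝ)) ⊤)

theorem extendedPoints_castSucc {N : ℕ} (y : Fin N → ℝ) (i : Fin (N + 1)) :
    extendedPoints y i.castSucc = ((Fin.cons 0 y : Fin (N + 1) → ℝ) i : WithTop ℝ) := by
  refine Fin.cases ?_ (fun i => ?_) i
  · simp [extendedPoints]
  · rw [← Fin.succ_castSucc]; simp [extendedPoints]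

theorem extendedPoints_succ_castSucc {N : ℕ} (y : Fin N → ℝ) (i : Fin N) :
    extendedPoints y i.castSucc.succ = y i := by simp [extendedPoints]

theorem extendedPoints_last {N : ℕ} (y : Fin N → ℝ) :
    extendedPoints y (Fin.last N).succ = ⊤ := by simp [extendedPoints]

/-- The `x` that interlace with `y` form a product of intervals. -/
theorem mem_pi_extendedPoints {N : ℕ} (y : Fin N → ℝ) (x : Fin (N + 1) → ℝ) :
    (x ∈ Set.univ.pi fun i : Fin (N + 1) =>
      closedInterval ((Fin.cons 0 y : Fin (N + 1) → ℝ) i) (extendedPoints y i.succ)) ↔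
      0 ≤ x 0 ∧ y ∈ interlacing x := by
  simp only [Set.mem_univ_pi, closedInterval, Set.mem_ofPred_eq, forall_and, interlacing]
  rw [Fin.forall_fin_succ (P := fun i => (Fin.cons 0 y : Fin (N + 1) → ℝ) i ≤ x i),
    Fin.forall_fin_succ' (P := fun i => (x i : WithTop ℝ) ≤ extendedPoints y i.succ)]
  simp only [extendedPoints_succ_castSucc, extendedPoints_last, Fin.cons_zero, Fin.cons_succ,
    WithTop.coe_le_coe, le_top, and_true]
  tauto

theorem pi_extendedPoints_subset {N : ℕ} (y : chamber N) :
    (Set.univ.pi fun i : Fin (N + 1) =>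
      closedInterval ((Fin.cons 0 y.1 : Fin (N + 1) → ℝ) i) (extendedPoints y.1 i.succ)) ⊆
      chamber (N + 1) := by
  intro x hx
  rw [mem_pi_extendedPoints] at hx
  have hm : Monotone x := Fin.monotone_iff_le_succ.2 fun i => (hx.2 i).1.trans (hx.2 i).2
  exact ⟨hm, fun i => hx.1.trans (hm (Fin.zero_le i))⟩

theorem cons_zero_nonneg {N : ℕ} (y : chamber N) (i : Fin (N + 1)) :
    0 ≤ (Fin.cons 0 y.1 : Fin (N + 1) → ℝ) i := by
  refine Fin.cases ?_ (fun i => ?_) i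
  · simp
  · simpa using y.2.2 i

theorem cons_zero_castSucc_le {N : ℕ} (y : chamber N) (i : Fin N) :
    (Fin.cons 0 y.1 : Fin (N + 1) → ℝ) i.castSucc ≤ y.1 i := by
  rcases Fin.eq_zero_or_eq_succ i.castSucc with h | ⟨m, h⟩
  · rw [h]; exact y.2.2 i
  · rw [h, Fin.cons_succ]
    refine y.2.1 (Fin.le_def.2 ?_)
    have := congrArg Fin.val h
    simp only [Fin.val_castSucc, Fin.val_succ] at this
    omega

theorem cons_zero_le_extendedPoints {N : ℕ} (y : chamber N) (i : Fin (N + 1)) :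
    ((Fin.cons 0 y.1 : Fin (N + 1) → ℝ) i : WithTop ℝ) ≤ extendedPoints y.1 i.succ := by
  refine Fin.lastCases ?_ (fun i => ?_) i
  · rw [extendedPoints_last]; exact le_top
  · rw [extendedPoints_succ_castSucc, WithTop.coe_le_coe]
    exact cons_zero_castSucc_le y i

/-- The columns are the weight `w` and multiples of the derivatives of `F j`. Their primitives are
evaluated at `0, y_1, …, y_N, ∞`. With the bordering ones, the row at `0` is `(1, 0, …, 0)`; after
its removal the row at `∞` is `(W ⊤, 0, …, 0)`, and the `F j (y_i)` remain. -/
theorem lintegral_corner_box {s α : ℝ} (hs : -1 < s) (hα : -1 < α) (N : ℕ) :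
    ∃ c : ℝ, ∀ y : chamber N, ∫⁻ x in Set.univ.pi fun i : Fin (N + 1) =>
      closedInterval ((Fin.cons 0 y.1 : Fin (N + 1) → ℝ) i) (extendedPoints y.1 i.succ),
        ENNReal.ofReal (vandermonde x * ∏ k, (x k ^ α *
          (1 + x k) ^ (-2 * ((N + 1 : ℕ) : ℝ) - α - s))) =
      ENNReal.ofReal (c * (vandermonde y.1 * ∏ k, (y.1 k ^ (α + 1) *
        (1 + y.1 k) ^ (-2 * (N : ℝ) - (α + 1) - s)))) := by
  -- Chosen so that the weight in `x` has exponent `-(b+1)`, that of a derivative, and the weight in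
  -- `y` has exponent `-b`.
  set b : ℝ := 2 * N + 1 + α + s with hb
  have hNb : (-2 * ((N + 1 : ℕ) : ℝ) - α - s) = -(b + 1) := by rw [hb]; push_cast; ring
  let w : ℝ → ℝ := fun t => t ^ α * (1 + t) ^ (-(b + 1))
  -- This is `a - b` for `a = α + 1 + j`, the coefficient of the higher power in `betaDeriv a b`. It
  -- is negative, so dividing by it makes that power monic.
  let e : Fin N → ℝ := fun j => j - 2 * N - s
  have hjN : ∀ j : Fin N, (j : ℝ) + 1 ≤ N := fun j => by exact_mod_cast j.2
  have hj0 : ∀ j : Fin N, (0 : ℝ) ≤ j := fun j => Nat.cast_nonneg _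
  have he : ∀ j, e j ≠ 0 := fun j => by
    have := hjN j; have := hj0 j; exact ne_of_lt (by simp only [e]; linarith)
  let F : Fin N → ℝ → ℝ := fun j t => t ^ (α + 1 + j) * (1 + t) ^ (-b)
  let f : Fin (N + 1) → ℝ → ℝ := Fin.cons w fun j t =>
    w t * (t ^ (j + 1 : ℕ) + (α + 1 + j) / e j * t ^ (j : ℕ))
  let W : WithTop ℝ → ℝ := fun p => ∫ t in closedInterval 0 p, w t
  have hw : IntegrableOn w (Set.Ioi 0) := integrableOn_rpow_mul_one_add_rpow hα (by
    rw [hb]; have : (0 : ℝ) ≤ N := Nat.cast_nonneg _; linarith)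
  have hf : ∀ (j : Fin N) t, 0 < t → f j.succ t = betaDeriv (α + 1 + j) b t / e j := by
    intro j t ht
    have h1 : t ^ (α + 1 + j - 1) = t ^ α * t ^ (j : ℕ) := by
      rw [← Real.rpow_natCast, ← Real.rpow_add ht]; congr 1; ring
    have h2 : t ^ (α + 1 + j) = t ^ α * t ^ (j + 1 : ℕ) := by
      rw [← Real.rpow_natCast, ← Real.rpow_add ht]; congr 1; push_cast; ring
    have h3 : α + 1 + j - b = e j := by simp only [e, hb]; ring
    have := he j
    simp only [f, Fin.cons_succ, betaDeriv, w]
    rw [h1, h2, h3]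
    field_simp
    ring
  have ha0 : ∀ j : Fin N, 0 < α + 1 + j := fun j => by linarith [hj0 j]
  have hab : ∀ j : Fin N, α + 1 + j < b := fun j => by
    rw [hb]; linarith [hj0 j, hjN j]
  -- The sign and `W ⊤` come from expanding along the row at infinity, the product from the column
  -- factors.
  refine ⟨(-1) ^ N * W ⊤ * ∏ j, (e j)⁻¹, fun y => ?_⟩
  rw [lintegral_pi_det _ (fun i => measurableSet_closedInterval _ _) f
    (fun i => Fin.cons (W (extendedPoints y.1 i))
      (fun j => zeroAtTop (F j) (extendedPoints y.1 i) / e j))]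
  · congr 1
    rw [det_first_row, det_last_row]
    · simp only [Matrix.of_apply, Fin.cons_zero, Fin.cons_succ, extendedPoints_last,
        extendedPoints_succ_castSucc, zeroAtTop_coe, one_mul]
      have hM : (Matrix.of fun i j : Fin N => F j (y.1 i) / e j) =
          Matrix.of fun i j : Fin N => (e j)⁻¹ * (Matrix.of fun i j : Fin N =>
            (y.1 i ^ (α + 1) * (1 + y.1 i) ^ (-b)) *
              (Matrix.of fun i j : Fin N => y.1 i ^ (j : ℕ)) i j) i j := by
        ext i j
        simp only [Matrix.of_apply, F]
        rw [Real.rpow_add_of_nonneg (y.2.2 i) (by linarith) (hj0 j), Real.rpow_natCast]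
        ring
      rw [hM, Matrix.det_mul_row, Matrix.det_mul_column, ← vandermonde_eq_det,
        show -2 * (N : ℝ) - (α + 1) - s = -b by rw [hb]; ring]
      ring
    · intro j
      simp only [Matrix.of_apply, Fin.cons_succ, extendedPoints_last, zeroAtTop_top, zero_div]
    · refine Fin.cases ?_ fun j => ?_
      · have : closedInterval 0 0 = {0} := (closedInterval_coe 0 0).trans (Set.Icc_self 0)
        simp [extendedPoints, W, this]
      · have : (0 : ℝ) ^ (α + 1 + j) = 0 := Real.zero_rpow (ha0 j).ne'
        simp [extendedPoints, ← WithTop.coe_zero, F, this]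
  · intro i
    refine Fin.cases ?_ fun j => ?_
    · exact integrableOn_closedInterval hw (cons_zero_nonneg y i) _
    · exact ((integrableOn_closedInterval (integrableOn_betaDeriv (ha0 j).le (hab j))
        (cons_zero_nonneg y i) _).div_const (e j)).congr
        (ae_restrict_closedInterval_eq (hf j) (cons_zero_nonneg y i) _).symm
  · intro i
    refine Fin.cases ?_ fun j => ?_
    · simp only [Fin.cons_zero, extendedPoints_castSucc]
      exact setIntegral_closedInterval_eq_sub hw (cons_zero_nonneg y i)
        (cons_zero_le_extendedPoints y i)
    · rw [integral_congr_ae (ae_restrict_closedInterval_eq (hf j) (cons_zero_nonneg y i) _),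
        integral_div, setIntegral_betaDeriv (ha0 j).le (hab j) (cons_zero_nonneg y i)
          (cons_zero_le_extendedPoints y i)]
      simp only [Fin.cons_succ, extendedPoints_castSucc, zeroAtTop_coe, F]
      ring
  · intro x _
    rw [vandermonde_eq_det_add_pred (fun j => (α + 1 + j) / e j), mul_comm, hNb,
      ← Matrix.det_mul_column]
    congr 1
    ext i j
    refine Fin.cases ?_ (fun j => ?_) j <;> simp [f, w]
  · intro x hx
    have hx := pi_extendedPoints_subset y hx
    refine mul_nonneg (vandermonde_nonneg hx.1) (Finset.prod_nonneg fun k _ => ?_)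
    have := hx.2 k
    positivity

/-- One factor `Δ(x)` of the weight cancels the denominator, and `N! Δ(y)` leaves the integral. -/
theorem ensembleWeight_mul_cornerDensity {s α : ℝ} (hs : -1 < s) (hα : -1 < α) (N : ℕ) :
    ∃ c : ENNReal, ∀ y : chamber N,
      ∫⁻ x : chamber (N + 1), ENNReal.ofReal (ensembleWeight s α x.1) *
        ENNReal.ofReal (cornerDensity x.1 y.1) ∂lebesgue (N + 1) =
      c * ENNReal.ofReal (ensembleWeight s (α + 1) y.1) := by
  obtain ⟨c, hc⟩ := lintegral_corner_box hs hα N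
  refine ⟨ENNReal.ofReal (N ! * c), fun y => ?_⟩
  have hy0 : 0 ≤ vandermonde y.1 := vandermonde_nonneg y.2.1
  rw [lintegral_lebesgue_indicator
    (f := fun x => ENNReal.ofReal (N ! * vandermonde y.1) * ENNReal.ofReal (vandermonde x *
      ∏ k, (x k ^ α * (1 + x k) ^ (-2 * ((N + 1 : ℕ) : ℝ) - α - s))))
    (MeasurableSet.univ_pi fun i => measurableSet_closedInterval _ _)
    (pi_extendedPoints_subset y)]
  · rw [lintegral_const_mul _ (by fun_prop), hc, ← ENNReal.ofReal_mul (by positivity),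
      ← ENNReal.ofReal_mul' (ensembleWeight_nonneg _ _ y), ensembleWeight]
    congr 1; ring
  · filter_upwards [ae_mem_interiorPoints (N + 1)] with x hx
    have hΔ := vandermonde_pos hx.1
    by_cases hi : y.1 ∈ interlacing x.1
    · rw [Set.indicator_of_mem ((mem_pi_extendedPoints _ _).2 ⟨x.2.2 0, hi⟩), cornerDensity,
        Set.indicator_of_mem hi, ← ENNReal.ofReal_mul (ensembleWeight_nonneg _ _ x),
        ← ENNReal.ofReal_mul (by positivity), ensembleWeight]
      congr 1
      field_simp
    · rw [Set.indicator_of_notMem (fun h => hi ((mem_pi_extendedPoints _ _).1 h).2), cornerDensity,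
        Set.indicator_of_notMem hi]
      simp

/-! ### The kernel `Λ^N_{α,N}` -/

theorem shiftedFactorial_pos {a : ℝ} (ha : 0 < a) (n : ℕ) : 0 < shiftedFactorial a n := by
  rw [shiftedFactorial_eq_prod]
  exact Finset.prod_pos fun j _ => by positivity

/-- The product form for fixed `x`, used for the total mass of the kernel. -/
theorem mem_sameSizeInterlacing_iff_mem_pi {N : ℕ} (x : chamber N) (y : Fin N → ℝ) :
    y ∈ sameSizeInterlacing x.1 ↔ y ∈ Set.univ.pi fun k : Fin N =>
      Set.Icc ((Fin.cons 0 x.1 : Fin (N + 1) → ℝ) k.castSucc) (x.1 k) := by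
  simp only [sameSizeInterlacing, Set.mem_univ_pi, Set.mem_Icc, Set.mem_ofPred_eq]
  constructor
  · rintro ⟨h1, h2⟩ k
    refine ⟨?_, (h1 k).2⟩
    rcases Fin.eq_zero_or_eq_succ k.castSucc with h | ⟨m, h⟩
    · rw [h]; exact (h1 k).1
    · rw [h, Fin.cons_succ]
      exact h2 m k (congrArg Fin.val h).symm
  · intro h
    refine ⟨fun k => ⟨(cons_zero_nonneg x _).trans (h k).1, (h k).2⟩, fun i j hij => ?_⟩
    have hj : j.castSucc = i.succ := Fin.ext hij.symm
    have := (h j).1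
    rwa [hj, Fin.cons_succ] at this

theorem sameSizeInterlacing_subset_chamber {N : ℕ} (x : chamber N) :
    sameSizeInterlacing x.1 ⊆ chamber N := by
  rintro y ⟨h1, h2⟩
  refine ⟨fun i j hij => ?_, fun k => (h1 k).1⟩
  rcases hij.eq_or_lt with rfl | hij
  · exact le_rfl
  · have hij : (i : ℕ) < j := hij
    have hj := j.2
    exact ((h1 i).2.trans (x.2.1 (Fin.le_def.2 (by simp only; omega)))).trans
      (h2 ⟨j - 1, by omega⟩ j (by simp only; omega))

theorem coe_le_extendedPoints_iff {N : ℕ} (y : Fin N → ℝ) (k : Fin N) (t : ℝ) :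
    (t : WithTop ℝ) ≤ extendedPoints y k.succ.succ ↔ ∀ j : Fin N, (k : ℕ) + 1 = j → t ≤ y j := by
  rcases Fin.eq_castSucc_or_eq_last k.succ with ⟨j, h⟩ | h
  · rw [h, extendedPoints_succ_castSucc, WithTop.coe_le_coe]
    have hv := congrArg Fin.val h
    simp only [Fin.val_succ, Fin.val_castSucc] at hv
    constructor
    · rintro ht i hi
      rwa [show i = j from Fin.ext (hi.symm.trans hv)]
    · intro ht
      exact ht j hv
  · rw [h, extendedPoints_last]
    have hv := congrArg Fin.val h
    simp only [Fin.val_succ, Fin.val_last] at hv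
    simp only [le_top, true_iff]
    intro j hj
    have := j.2
    omega

/-- The product form for fixed `y`, used to integrate out `x`; the last interval is unbounded. -/
theorem mem_sameSizeInterlacing_iff_mem_pi_closedInterval {N : ℕ} (y : chamber N)
    (x : Fin N → ℝ) :
    y.1 ∈ sameSizeInterlacing x ↔ x ∈ Set.univ.pi fun k : Fin N =>
      closedInterval (y.1 k) (extendedPoints y.1 k.succ.succ) := by
  simp only [sameSizeInterlacing, Set.mem_univ_pi, closedInterval, Set.mem_ofPred_eq,
    coe_le_extendedPoints_iff, forall_and]
  have := y.2.2
  tauto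

theorem pi_closedInterval_subset_chamber {N : ℕ} (y : chamber N) :
    (Set.univ.pi fun k : Fin N => closedInterval (y.1 k) (extendedPoints y.1 k.succ.succ)) ⊆
      chamber N := by
  intro x hx
  rw [← mem_sameSizeInterlacing_iff_mem_pi_closedInterval] at hx
  obtain ⟨h1, h2⟩ := hx
  refine ⟨fun i j hij => ?_, fun k => (h1 k).1.trans (h1 k).2⟩
  rcases hij.eq_or_lt with rfl | hij
  · exact le_rfl
  · have hij : (i : ℕ) < j := hij
    have hj := j.2
    exact ((h2 i ⟨i + 1, by omega⟩ rfl).trans (y.2.1 (Fin.le_def.2 (by simp only; omega)))).trans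
      (h1 j).2

theorem measurable_sameSizeDensity (α : ℝ) (N : ℕ) :
    Measurable (Function.uncurry fun (x : chamber N) (y : chamber N) =>
      ENNReal.ofReal (sameSizeDensity α x.1 y.1)) := by
  have hS : MeasurableSet {p : chamber N × chamber N | p.2.1 ∈ sameSizeInterlacing p.1.1} := by
    simp only [sameSizeInterlacing, Set.mem_ofPred_eq]
    simp only [Set.ofPred_forall, Set.ofPred_and]
    refine (MeasurableSet.iInter fun k =>
      (measurableSet_le measurable_const (measurable_coord measurable_snd _)).inter
        (measurableSet_le (measurable_coord measurable_snd _)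
          (measurable_coord measurable_fst _))).inter ?_
    exact MeasurableSet.iInter fun i => MeasurableSet.iInter fun j => MeasurableSet.iInter fun _ =>
      measurableSet_le (measurable_coord measurable_fst _) (measurable_coord measurable_snd _)
  have hm : Measurable fun p : chamber N × chamber N =>
      shiftedFactorial (α + 1) N * (∏ k, p.2.1 k ^ α / p.1.1 k ^ (α + 1)) *
        (vandermonde p.2.1 / vandermonde p.1.1) := by
    have h1 : ∀ k, Measurable fun p : chamber N × chamber N => p.1.1 k :=
      measurable_coord measurable_fst
    have h2 : ∀ k, Measurable fun p : chamber N × chamber N => p.2.1 k :=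
      measurable_coord measurable_snd
    fun_prop
  exact (hm.indicator hS).ennreal_ofReal

/-- The primitives `t^{α+j+1}/(α+j+1)` vanish at `0`, which removes the first row. The denominators
multiply to `(α+1)_N`, and `x_i^{α+1}` comes out of each row. -/
theorem lintegral_sameSizeDensity {α : ℝ} (hα : -1 < α) {N : ℕ} {x : chamber N}
    (hx : x ∈ interiorPoints N) :
    ∫⁻ y : chamber N, ENNReal.ofReal (sameSizeDensity α x.1 y.1) ∂lebesgue N = 1 := by
  have hΔ := vandermonde_pos hx.1
  have hP := shiftedFactorial_pos (show 0 < α + 1 by linarith) N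
  have hX : 0 < ∏ k, x.1 k ^ (α + 1) := Finset.prod_pos fun k _ => by
    have := hx.2 k; positivity
  have hset : sameSizeInterlacing x.1 = Set.univ.pi fun k : Fin N =>
      Set.Icc ((Fin.cons 0 x.1 : Fin (N + 1) → ℝ) k.castSucc) (x.1 k) :=
    Set.ext (mem_sameSizeInterlacing_iff_mem_pi x)
  have hj0 : ∀ j : Fin N, (0 : ℝ) ≤ j := fun j => Nat.cast_nonneg _
  have hae : ∀ (i j : Fin N), (fun t : ℝ => t ^ α * t ^ (j : ℕ)) =ᵐ[volume.restrict
      (Set.Icc ((Fin.cons 0 x.1 : Fin (N + 1) → ℝ) i.castSucc) (x.1 i))]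
        fun t => t ^ (α + j) := by
    intro i j
    rw [← closedInterval_coe]
    refine ae_restrict_closedInterval_eq (fun t ht => ?_) (cons_zero_nonneg x _) _
    rw [Real.rpow_add ht, Real.rpow_natCast]
  rw [lintegral_lebesgue_indicator (B := sameSizeInterlacing x.1)
    (f := fun y => ENNReal.ofReal (shiftedFactorial (α + 1) N / (∏ k, x.1 k ^ (α + 1)) /
      vandermonde x.1) * ENNReal.ofReal ((∏ k, y k ^ α) * vandermonde y))
    (by rw [hset]; exact MeasurableSet.univ_pi fun _ => measurableSet_Icc)
    (sameSizeInterlacing_subset_chamber x)]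
  · rw [lintegral_const_mul _ (by fun_prop), hset, lintegral_pi_det _
      (fun _ => measurableSet_Icc) (fun j t => t ^ α * t ^ (j : ℕ))
      (fun i j => (Fin.cons 0 x.1 : Fin (N + 1) → ℝ) i ^ (α + j + 1) / (α + j + 1))]
    · have hdet : (Matrix.of fun i : Fin (N + 1) => (Fin.cons 1
          (fun j : Fin N => (Fin.cons 0 x.1 : Fin (N + 1) → ℝ) i ^ (α + j + 1) / (α + j + 1)) :
            Fin (N + 1) → ℝ)).det =
          (∏ k, x.1 k ^ (α + 1)) * vandermonde x.1 / shiftedFactorial (α + 1) N := by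
        rw [det_first_row]
        · simp only [Matrix.of_apply, Fin.cons_zero, Fin.cons_succ, one_mul]
          have hM : (Matrix.of fun i j : Fin N => x.1 i ^ (α + j + 1) / (α + j + 1)) =
              Matrix.of fun i j : Fin N => (α + 1 + j)⁻¹ * (Matrix.of fun i j : Fin N =>
                x.1 i ^ (α + 1) * (Matrix.of fun i j : Fin N => x.1 i ^ (j : ℕ)) i j) i j := by
            ext i j
            simp only [Matrix.of_apply]
            rw [show α + j + 1 = (α + 1) + (j : ℕ) by ring, Real.rpow_add (hx.2 i),
              Real.rpow_natCast]
            ring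
          rw [hM, Matrix.det_mul_row, Matrix.det_mul_column, ← vandermonde_eq_det,
            shiftedFactorial_eq_prod, Finset.prod_inv_distrib]
          ring
        · intro j
          have : (0 : ℝ) ^ (α + j + 1) = 0 := Real.zero_rpow (by linarith [hj0 j])
          simp [this]
      rw [hdet, ← ENNReal.ofReal_mul (by positivity)]
      convert ENNReal.ofReal_one using 2
      field_simp
    · intro i j
      exact (integrableOn_Icc_rpow (by linarith [hj0 j]) (cons_zero_castSucc_le x i)).congr
        (hae i j).symm
    · intro i j
      rw [integral_congr_ae (hae i j), setIntegral_Icc_rpow (by linarith [hj0 j])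
        (cons_zero_castSucc_le x i)]
      simp
    · intro y _
      rw [vandermonde_eq_det, ← Matrix.det_mul_column]
      rfl
    · intro y hy
      rw [← hset] at hy
      have hy := sameSizeInterlacing_subset_chamber x hy
      refine mul_nonneg (Finset.prod_nonneg fun k _ => ?_) (vandermonde_nonneg hy.1)
      have := hy.2 k
      positivity
  · refine ae_of_all _ fun y => ?_
    by_cases hy : y.1 ∈ sameSizeInterlacing x.1
    · rw [sameSizeDensity, Set.indicator_of_mem hy, Set.indicator_of_mem hy,
        ← ENNReal.ofReal_mul (by positivity), Finset.prod_div_distrib]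
      congr 1; ring
    · rw [sameSizeDensity, Set.indicator_of_notMem hy, Set.indicator_of_notMem hy]
      simp

/-- The powers `x_k^{α+1}` of the weight have cancelled those of the density, so here every column,
the one with `j = 0` included, has an explicit primitive `t^j (1+t)^{-b}` up to a factor. Only the
row at infinity collapses, to `(1, 0, …, 0)`. -/
theorem lintegral_sameSize_box {s α : ℝ} (hs : -1 < s) (hα : -1 < α) (n : ℕ) :
    ∃ c : ℝ, ∀ y : chamber (n + 1), ∫⁻ x in Set.univ.pi fun k : Fin (n + 1) =>
      closedInterval (y.1 k) (extendedPoints y.1 k.succ.succ),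
        ENNReal.ofReal (vandermonde x * ∏ k,
          (1 + x k) ^ (-2 * ((n + 1 : ℕ) : ℝ) - (α + 1) - s)) =
      ENNReal.ofReal (c * (vandermonde y.1 * ∏ k,
        (1 + y.1 k) ^ (-2 * ((n + 1 : ℕ) : ℝ) - α - s))) := by
  set b : ℝ := 2 * (n + 1) + α + s with hb
  have hNb : (-2 * ((n + 1 : ℕ) : ℝ) - (α + 1) - s) = -(b + 1) := by rw [hb]; push_cast; ring
  have hNb' : (-2 * ((n + 1 : ℕ) : ℝ) - α - s) = -b := by rw [hb]; push_cast; ring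
  let w : ℝ → ℝ := fun t => (1 + t) ^ (-(b + 1))
  have hn : (0 : ℝ) ≤ n := Nat.cast_nonneg _
  have hjN : ∀ j : Fin (n + 1), (j : ℝ) ≤ n := fun j => by
    exact_mod_cast Nat.lt_succ_iff.1 j.2
  have hj0 : ∀ j : Fin (n + 1), (0 : ℝ) ≤ j := fun j => Nat.cast_nonneg _
  have hab : ∀ j : Fin (n + 1), (j : ℝ) < b := fun j => by
    rw [hb]; linarith [hj0 j, hjN j]
  have he : ∀ j : Fin (n + 1), (j : ℝ) - b ≠ 0 := fun j => (sub_neg.2 (hab j)).ne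
  let F : Fin (n + 1) → ℝ → ℝ := fun j t => t ^ (j : ℝ) * (1 + t) ^ (-b)
  -- The ratio of the two coefficients of `betaDeriv (j+1) b`.
  let c : Fin n → ℝ := fun j => ((j : ℝ) + 1) / ((j : ℝ) + 1 - b)
  let f : Fin (n + 1) → ℝ → ℝ := Fin.cons w fun j t =>
    w t * (t ^ (j + 1 : ℕ) + c j * t ^ (j : ℕ))
  have hf : ∀ (j : Fin (n + 1)) t, 0 < t → f j t = betaDeriv j b t / (j - b) := by
    intro j t ht
    have hj := he j
    refine Fin.cases ?_ (fun j hj => ?_) j hj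
    · intro h0
      have h0 : (0 : ℝ) - b ≠ 0 := by simpa using h0
      simp only [f, Fin.cons_zero, betaDeriv, w, Fin.val_zero, Nat.cast_zero, Real.rpow_zero]
      field_simp
      ring
    · have h1 : t ^ (((j.succ : ℕ) : ℝ) - 1) = t ^ (j : ℕ) := by
        rw [← Real.rpow_natCast]; congr 1; simp
      have hj' : (j : ℝ) + 1 - b ≠ 0 := by simpa using hj
      simp only [f, Fin.cons_succ, betaDeriv, w, c]
      rw [h1, Real.rpow_natCast]
      simp only [Fin.val_succ, Nat.cast_add, Nat.cast_one]
      field_simp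
      ring
  refine ⟨(-1) ^ (n + 1) * ∏ j : Fin (n + 1), ((j : ℝ) - b)⁻¹, fun y => ?_⟩
  have hle : ∀ i : Fin (n + 1), (y.1 i : WithTop ℝ) ≤ extendedPoints y.1 i.succ.succ := fun i =>
    (coe_le_extendedPoints_iff _ _ _).2 fun j hj => y.2.1 (Fin.le_def.2 (by omega))
  rw [lintegral_pi_det _ (fun i => measurableSet_closedInterval _ _) f
    (fun i j => zeroAtTop (F j) (extendedPoints y.1 i.succ) / (j - b))]
  · congr 1
    rw [det_last_row]
    · simp only [Matrix.of_apply, Fin.cons_zero, Fin.cons_succ,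
        extendedPoints_succ_castSucc, zeroAtTop_coe, mul_one]
      have hM : (Matrix.of fun i j : Fin (n + 1) => F j (y.1 i) / (j - b)) =
          Matrix.of fun i j : Fin (n + 1) => ((j : ℝ) - b)⁻¹ * (Matrix.of fun i j : Fin (n + 1) =>
            (1 + y.1 i) ^ (-b) *
              (Matrix.of fun i j : Fin (n + 1) => y.1 i ^ (j : ℕ)) i j) i j := by
        ext i j
        simp only [Matrix.of_apply, F, Real.rpow_natCast]
        ring
      rw [hM, Matrix.det_mul_row, Matrix.det_mul_column, ← vandermonde_eq_det, hNb']
      ring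
    · intro j
      simp only [Matrix.of_apply, Fin.cons_succ, extendedPoints_last, zeroAtTop_top, zero_div]
  · intro i j
    exact ((integrableOn_closedInterval (integrableOn_betaDeriv (hj0 j) (hab j))
        (y.2.2 i) _).div_const _).congr
        (ae_restrict_closedInterval_eq (hf j) (y.2.2 i) _).symm
  · intro i j
    rw [integral_congr_ae (ae_restrict_closedInterval_eq (hf j) (y.2.2 i) _),
      integral_div, setIntegral_betaDeriv (hj0 j) (hab j) (y.2.2 i) (hle i),
      extendedPoints_succ_castSucc]
    simp only [zeroAtTop_coe, F]
    ring
  · intro x _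
    rw [vandermonde_eq_det_add_pred c, mul_comm, hNb, ← Matrix.det_mul_column]
    congr 1
    ext i j
    refine Fin.cases ?_ (fun j => ?_) j <;> simp [f, w]
  · intro x hx
    have hx := pi_closedInterval_subset_chamber y hx
    refine mul_nonneg (vandermonde_nonneg hx.1) (Finset.prod_nonneg fun k _ => ?_)
    have := hx.2 k
    positivity

theorem ensembleWeight_mul_sameSizeDensity {s α : ℝ} (hs : -1 < s) (hα : -1 < α) {N : ℕ}
    (hN : 1 ≤ N) :
    ∃ c : ENNReal, ∀ y : chamber N,
      ∫⁻ x : chamber N, ENNReal.ofReal (ensembleWeight s (α + 1) x.1) *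
        ENNReal.ofReal (sameSizeDensity α x.1 y.1) ∂lebesgue N =
      c * ENNReal.ofReal (ensembleWeight s α y.1) := by
  -- The two-term change of basis treats the column `j = 0` separately, which requires a size `n +
  -- 1`.
  obtain ⟨n, rfl⟩ := Nat.exists_eq_succ_of_ne_zero (Nat.one_le_iff_ne_zero.1 hN)
  obtain ⟨c, hc⟩ := lintegral_sameSize_box hs hα n
  refine ⟨ENNReal.ofReal (shiftedFactorial (α + 1) (n + 1) * c), fun y => ?_⟩
  have hy0 : 0 ≤ vandermonde y.1 := vandermonde_nonneg y.2.1
  have hP := shiftedFactorial_pos (show 0 < α + 1 by linarith) (n + 1)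
  have hyp : 0 ≤ ∏ k, y.1 k ^ α := Finset.prod_nonneg fun k _ => by
    have := y.2.2 k; positivity
  rw [lintegral_lebesgue_indicator
    (f := fun x => ENNReal.ofReal (shiftedFactorial (α + 1) (n + 1) * (∏ k, y.1 k ^ α) *
      vandermonde y.1) * ENNReal.ofReal (vandermonde x *
        ∏ k, (1 + x k) ^ (-2 * ((n + 1 : ℕ) : ℝ) - (α + 1) - s)))
    (MeasurableSet.univ_pi fun i => measurableSet_closedInterval _ _)
    (pi_closedInterval_subset_chamber y)]
  · rw [lintegral_const_mul _ (by fun_prop), hc, ← ENNReal.ofReal_mul (by positivity),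
      ← ENNReal.ofReal_mul' (ensembleWeight_nonneg _ _ y), ensembleWeight, Finset.prod_mul_distrib]
    congr 1; ring
  · filter_upwards [ae_mem_interiorPoints (n + 1)] with x hx
    have hΔ := vandermonde_pos hx.1
    have hX : 0 < ∏ k, x.1 k ^ (α + 1) := Finset.prod_pos fun k _ => by
      have := hx.2 k; positivity
    by_cases hi : y.1 ∈ sameSizeInterlacing x.1
    · rw [Set.indicator_of_mem ((mem_sameSizeInterlacing_iff_mem_pi_closedInterval _ _).1 hi),
        sameSizeDensity, Set.indicator_of_mem hi,
        ← ENNReal.ofReal_mul (ensembleWeight_nonneg _ _ x), ← ENNReal.ofReal_mul (by positivity),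
        ensembleWeight, Finset.prod_div_distrib, Finset.prod_mul_distrib]
      congr 1
      field_simp
    · rw [Set.indicator_of_notMem
        (fun h => hi ((mem_sameSizeInterlacing_iff_mem_pi_closedInterval _ _).2 h)),
        sameSizeDensity, Set.indicator_of_notMem hi]
      simp

/-! ### The kernel `Λ^{N+1}_{α,N}` -/

theorem le_upperEnd_iff {N : ℕ} (x : Fin (N + 1) → ℝ) (y : Fin N → ℝ) (k : Fin N) (t : ℝ) :
    t ≤ upperEnd x y k ↔ t ≤ x k.succ ∧ ∀ j : Fin N, (k : ℕ) + 1 = j → t ≤ y j := by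
  unfold upperEnd
  split_ifs with h
  · rw [le_min_iff]
    refine and_congr_right fun _ => ⟨fun ht j hj => ?_, fun ht => ht _ rfl⟩
    rwa [show j = ⟨k + 1, h⟩ from Fin.ext hj.symm]
  · refine ⟨fun ht => ⟨ht, fun j hj => ?_⟩, fun ht => ht.1⟩
    have := j.2
    omega

/-- The `z` between `x` and `y` form a product of intervals. -/
theorem mem_pi_link_iff {N : ℕ} (x : Fin (N + 1) → ℝ) (y : chamber N) (z : Fin N → ℝ) :
    (z ∈ Set.univ.pi fun k : Fin N => Set.Icc (max (x k.castSucc) (y.1 k)) (upperEnd x y.1 k)) ↔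
      z ∈ interlacing x ∧ y.1 ∈ sameSizeInterlacing z := by
  simp only [sameSizeInterlacing, interlacing, Set.mem_univ_pi, Set.mem_Icc, Set.mem_ofPred_eq,
    le_upperEnd_iff, max_le_iff, forall_and]
  have := y.2.2
  tauto

/-- Under the indicator conditions the end points are in order, so the oriented interval integrals
in `linkDensity` are integrals over sets and carry no sign. -/
theorem max_le_upperEnd {N : ℕ} {x : chamber (N + 1)} {y : chamber N}
    (h : ∀ k : Fin N, y.1 k ∈ Set.Icc (prevCoord x.1 k) (x.1 k.succ)) (k : Fin N) :
    max (x.1 k.castSucc) (y.1 k) ≤ upperEnd x.1 y.1 k := by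
  rw [le_upperEnd_iff]
  refine ⟨max_le (x.2.1 (Fin.castSucc_le_succ k)) (h k).2, fun j hj => max_le ?_
    (y.2.1 (Fin.le_def.2 (by omega)))⟩
  have := (h j).1
  unfold prevCoord at this
  rw [if_neg (by omega)] at this
  convert this using 2
  ext
  simp only [Fin.val_castSucc]
  omega

/-- The counterpart of `max_le_upperEnd`: where an indicator in `linkDensity` vanishes, no
intermediate `z` exists, so the composed density vanishes too. -/
theorem pi_link_eq_empty {N : ℕ} {x : chamber (N + 1)} {y : chamber N} {k : Fin N}
    (hk : y.1 k ∉ Set.Icc (prevCoord x.1 k) (x.1 k.succ)) :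
    (Set.univ.pi fun k : Fin N =>
      Set.Icc (max (x.1 k.castSucc) (y.1 k)) (upperEnd x.1 y.1 k)) = ∅ := by
  refine Set.eq_empty_of_forall_notMem fun z hz => hk ?_
  obtain ⟨h1, h2, h3⟩ := (mem_pi_link_iff _ _ _).1 hz
  refine ⟨?_, (h2 k).2.trans (h1 k).2⟩
  unfold prevCoord
  split_ifs with h
  · exact y.2.2 k
  · have hk := k.2
    let m : Fin N := ⟨k - 1, by omega⟩
    exact (h1 m).1.trans (h3 m k (by simp only [m]; omega))

/-- The density of `Λ^{N+1}_{α,N}` is that of the composition of `L^{N+1}_N` and `Λ^N_{α,N}`. -/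
theorem ofReal_linkDensity {α : ℝ} (hα : -1 < α) {N : ℕ} {x : chamber (N + 1)}
    (hx : x ∈ interiorPoints (N + 1)) (y : chamber N) :
    ENNReal.ofReal (linkDensity α x.1 y.1) =
      ∫⁻ z : chamber N, ENNReal.ofReal (cornerDensity x.1 z.1) *
        ENNReal.ofReal (sameSizeDensity α z.1 y.1) ∂lebesgue N := by
  have hΔ := vandermonde_pos hx.1
  have hy0 : 0 ≤ vandermonde y.1 := vandermonde_nonneg y.2.1
  have hP := shiftedFactorial_pos (show 0 < α + 1 by linarith) N
  set J : Fin N → Set ℝ := fun k =>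
    Set.Icc (max (x.1 k.castSucc) (y.1 k)) (upperEnd x.1 y.1 k) with hJ
  have hmJ : MeasurableSet (Set.univ.pi J) := MeasurableSet.univ_pi fun _ => measurableSet_Icc
  have hsub : Set.univ.pi J ⊆ chamber N := fun z hz =>
    interlacing_subset_chamber x ((mem_pi_link_iff _ _ _).1 hz).1
  rw [lintegral_lebesgue_indicator (B := Set.univ.pi J)
    (f := fun z => ENNReal.ofReal ((N ! : ℝ) * shiftedFactorial (α + 1) N *
      (vandermonde y.1 / vandermonde x.1)) * ENNReal.ofReal (∏ k, y.1 k ^ α / z k ^ (α + 1)))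
    hmJ hsub]
  · rw [lintegral_const_mul _ (by fun_prop)]
    by_cases h : ∀ k : Fin N, y.1 k ∈ Set.Icc (prevCoord x.1 k) (x.1 k.succ)
    · have hint : ∀ k, Integrable (fun t : ℝ => y.1 k ^ α / t ^ (α + 1))
          (volume.restrict (J k)) := by
        intro k
        refine ContinuousOn.integrableOn_Icc ?_
        have hpos : ∀ t ∈ Set.Icc (max (x.1 k.castSucc) (y.1 k)) (upperEnd x.1 y.1 k), 0 < t :=
          fun t ht => (hx.2 _).trans_le ((le_max_left _ _).trans ht.1)
        refine continuousOn_const.div (continuousOn_id.rpow_const fun t ht =>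
          Or.inl (hpos t ht).ne') fun t ht => (Real.rpow_pos_of_pos (hpos t ht) _).ne'
      have hprod := Integrable.fintype_prod hint
      have hnn : 0 ≤ᵐ[Measure.pi fun k => volume.restrict (J k)]
          fun z : Fin N → ℝ => ∏ k, y.1 k ^ α / z k ^ (α + 1) := by
        rw [← Measure.restrict_pi_pi]
        refine (ae_restrict_iff' hmJ).2 (ae_of_all _ fun z hz => Finset.prod_nonneg fun k _ => ?_)
        have := (hsub hz).2 k
        have := y.2.2 k
        positivity
      have hfac : ∀ k : Fin N, (Set.Icc (prevCoord x.1 k) (x.1 k.succ)).indicator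
          (fun yk => ∫ z in (max (x.1 k.castSucc) yk)..(upperEnd x.1 y.1 k),
            yk ^ α / z ^ (α + 1)) (y.1 k) = ∫ t in J k, y.1 k ^ α / t ^ (α + 1) := by
        intro k
        rw [Set.indicator_of_mem (h k), hJ, integral_Icc_eq_integral_Ioc,
          intervalIntegral.integral_of_le (max_le_upperEnd h k)]
      rw [linkDensity, ENNReal.ofReal_mul (by positivity), volume_pi, Measure.restrict_pi_pi,
        ← ofReal_integral_eq_lintegral_ofReal hprod hnn,
        integral_fintype_prod_eq_prod (fun k t => y.1 k ^ α / t ^ (α + 1)),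
        Finset.prod_congr rfl fun k _ => hfac k]
    · obtain ⟨k, hk⟩ := not_forall.1 h
      rw [linkDensity, Finset.prod_eq_zero (Finset.mem_univ k) (Set.indicator_of_notMem hk _),
        hJ, pi_link_eq_empty hk]
      simp
  -- For almost every `z` the factor `Δ(z)` is nonzero and cancels between the two densities, which
  -- leaves a product over coordinates.
  · filter_upwards [ae_mem_interiorPoints N] with z hz
    have hz0 := vandermonde_pos hz.1
    by_cases hi : z.1 ∈ interlacing x.1 ∧ y.1 ∈ sameSizeInterlacing z.1
    · rw [Set.indicator_of_mem ((mem_pi_link_iff _ _ _).2 hi), cornerDensity, sameSizeDensity,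
        Set.indicator_of_mem hi.1, Set.indicator_of_mem hi.2, ← ENNReal.ofReal_mul (by positivity),
        ← ENNReal.ofReal_mul (by positivity)]
      congr 1
      field_simp
    · rw [Set.indicator_of_notMem fun h => hi ((mem_pi_link_iff _ _ _).1 h), cornerDensity,
        sameSizeDensity]
      rcases not_and_or.1 hi with h | h <;> simp [Set.indicator_of_notMem h]

/-! ### Images of the ensembles -/

theorem fellerExtension_of_mem {X Y : Type*} [TopologicalSpace X] [TopologicalSpace Y]
    [MeasurableSpace Y] {S : Set X} {k : X → Measure Y} {x : X} (hx : x ∈ S) :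
    fellerExtension S k x = k x := if_pos hx

theorem measurable_ofReal_ensembleWeight (s α : ℝ) (N : ℕ) :
    Measurable fun x : chamber N => ENNReal.ofReal (ensembleWeight s α x.1) :=
  ((measurable_ensembleWeight s α N).comp measurable_subtype_coe).ennreal_ofReal

theorem ensemble_bind_cornerKernel {s α : ℝ} (hs : -1 < s) (hα : -1 < α) (N : ℕ) :
    (ensemble s α (N + 1)).bind (cornerKernel N) = ensemble s (α + 1) N := by
  obtain ⟨c, hc⟩ := ensembleWeight_mul_cornerDensity hs hα N
  refine bind_normalized_withDensity (measurable_ofReal_ensembleWeight _ _ _)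
    (measurable_ofReal_ensembleWeight _ _ _) (measurable_cornerDensity N) ?_ ?_ (ae_of_all _ hc)
    (unnormalizedEnsemble_univ_ne_zero s α (N + 1))
    (unnormalizedEnsemble_univ_ne_top hs hα (N + 1))
  · filter_upwards [ae_mem_interiorPoints (N + 1)] with x hx
    exact fellerExtension_of_mem hx.1
  · filter_upwards [ae_mem_interiorPoints (N + 1)] with x hx
    exact lintegral_cornerDensity hx.1

theorem ensemble_bind_sameSizeKernel {s α : ℝ} (hs : -1 < s) (hα : -1 < α) {N : ℕ} (hN : 1 ≤ N) :
    (ensemble s (α + 1) N).bind (sameSizeKernel α N) = ensemble s α N := by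
  obtain ⟨c, hc⟩ := ensembleWeight_mul_sameSizeDensity hs hα hN
  refine bind_normalized_withDensity (measurable_ofReal_ensembleWeight _ _ _)
    (measurable_ofReal_ensembleWeight _ _ _) (measurable_sameSizeDensity α N) ?_ ?_
    (ae_of_all _ hc) (unnormalizedEnsemble_univ_ne_zero s (α + 1) N)
    (unnormalizedEnsemble_univ_ne_top hs (by linarith) N)
  · filter_upwards [ae_mem_interiorPoints N] with x hx
    exact fellerExtension_of_mem hx
  · filter_upwards [ae_mem_interiorPoints N] with x hx
    exact lintegral_sameSizeDensity hα hx

theorem ensemble_bind_linkKernel {s α : ℝ} (hs : -1 < s) (hα : -1 < α) {N : ℕ} (hN : 1 ≤ N) :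
    (ensemble s α (N + 1)).bind (linkKernel α N) = ensemble s α N := by
  obtain ⟨c, hc⟩ := ensembleWeight_mul_cornerDensity hs hα N
  obtain ⟨d, hd⟩ := ensembleWeight_mul_sameSizeDensity hs hα hN
  have hk1 := measurable_cornerDensity N
  have hk2 := measurable_sameSizeDensity α N
  have hu := measurable_ofReal_ensembleWeight s α (N + 1)
  -- The composed density stands in for `linkDensity`, with which it agrees at interior `x`. Its
  -- joint measurability follows from that of the two factors.
  have hk : Measurable (Function.uncurry fun (x : chamber (N + 1)) (y : chamber N) =>
      ∫⁻ z : chamber N, ENNReal.ofReal (cornerDensity x.1 z.1) *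
        ENNReal.ofReal (sameSizeDensity α z.1 y.1) ∂lebesgue N) := by
    refine Measurable.lintegral_prod_right' (f := fun p : (chamber (N + 1) × chamber N) × chamber N =>
      ENNReal.ofReal (cornerDensity p.1.1.1 p.2.1) * ENNReal.ofReal (sameSizeDensity α p.2.1 p.1.2.1))
      ?_
    exact (hk1.comp ((measurable_fst.comp measurable_fst).prodMk measurable_snd)).mul
      (hk2.comp (measurable_snd.prodMk (measurable_snd.comp measurable_fst)))
  refine bind_normalized_withDensity (c := c * d) hu
    (measurable_ofReal_ensembleWeight _ _ _) hk ?_ ?_ (ae_of_all _ fun y => ?_)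
    (unnormalizedEnsemble_univ_ne_zero s α (N + 1))
    (unnormalizedEnsemble_univ_ne_top hs hα (N + 1))
  · filter_upwards [ae_mem_interiorPoints (N + 1)] with x hx
    rw [linkKernel, fellerExtension_of_mem hx]
    congr 1
    funext y
    exact ofReal_linkDensity hα hx y
  · filter_upwards [ae_mem_interiorPoints (N + 1)] with x hx
    -- Mass one for the composition: integrate `y` first, then `z`.
    rw [lintegral_lintegral_swap]
    · rw [← lintegral_cornerDensity hx.1]
      refine lintegral_congr_ae ?_
      filter_upwards [ae_mem_interiorPoints N] with z hz
      rw [lintegral_const_mul _ hk2.of_uncurry_left, lintegral_sameSizeDensity hα hz, mul_one]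
    · exact ((hk1.of_uncurry_left (x := x)).comp measurable_snd |>.mul
        (hk2.comp measurable_swap)).aemeasurable
  · calc ∫⁻ x : chamber (N + 1), ENNReal.ofReal (ensembleWeight s α x.1) *
          ∫⁻ z : chamber N, ENNReal.ofReal (cornerDensity x.1 z.1) *
            ENNReal.ofReal (sameSizeDensity α z.1 y.1) ∂lebesgue N ∂lebesgue (N + 1)
        = ∫⁻ x : chamber (N + 1), ∫⁻ z : chamber N, ENNReal.ofReal (ensembleWeight s α x.1) *
            (ENNReal.ofReal (cornerDensity x.1 z.1) *
              ENNReal.ofReal (sameSizeDensity α z.1 y.1)) ∂lebesgue N ∂lebesgue (N + 1) := by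
          refine lintegral_congr fun x => (lintegral_const_mul _ ?_).symm
          exact hk1.of_uncurry_left.mul hk2.of_uncurry_right
      _ = ∫⁻ z : chamber N, ∫⁻ x : chamber (N + 1), ENNReal.ofReal (ensembleWeight s α x.1) *
            (ENNReal.ofReal (cornerDensity x.1 z.1) *
              ENNReal.ofReal (sameSizeDensity α z.1 y.1)) ∂lebesgue (N + 1) ∂lebesgue N := by
          refine lintegral_lintegral_swap (Measurable.aemeasurable ?_)
          exact (hu.comp measurable_fst).mul (hk1.mul
            ((hk2.of_uncurry_right (y := y)).comp measurable_snd))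
      _ = ∫⁻ z : chamber N, c * (ENNReal.ofReal (ensembleWeight s (α + 1) z.1) *
            ENNReal.ofReal (sameSizeDensity α z.1 y.1)) ∂lebesgue N := by
          refine lintegral_congr fun z => ?_
          simp_rw [← mul_assoc]
          refine (lintegral_mul_const _ (hu.mul hk1.of_uncurry_right)).trans ?_
          exact congrArg (· * _) (hc z)
      _ = c * d * ENNReal.ofReal (ensembleWeight s α y.1) := by
          refine (lintegral_const_mul _
            ((measurable_ofReal_ensembleWeight _ _ _).mul hk2.of_uncurry_right)).trans ?_
          rw [mul_assoc]
          exact congrArg (c * ·) (hd y)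

end Pickrell

end

theorem mainTheorem6 (s α : ℝ) (hs : -1 < s) (hα : -1 < α) :
    (∀ N : ℕ, 1 ≤ N →
      (Pickrell.ensemble s α (N + 1)).bind (Pickrell.cornerKernel N)
          = Pickrell.ensemble s (α + 1) N ∧
      (Pickrell.ensemble s (α + 1) N).bind (Pickrell.sameSizeKernel α N)
          = Pickrell.ensemble s α N ∧
      (Pickrell.ensemble s α (N + 1)).bind (Pickrell.linkKernel α N)
          = Pickrell.ensemble s α N) ∧
    Pickrell.IsCoherent (Pickrell.linkKernel α) (Pickrell.ensemble s α) :=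
  ⟨fun N hN => ⟨Pickrell.ensemble_bind_cornerKernel hs hα N,
    Pickrell.ensemble_bind_sameSizeKernel hs hα hN, Pickrell.ensemble_bind_linkKernel hs hα hN⟩,
    fun N _ => Pickrell.isProbabilityMeasure_ensemble hs hα N,
    fun _ hN => Pickrell.ensemble_bind_linkKernel hs hα hN⟩
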